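/- Let $\beta=\begin{pmatrix}\mathbb I_2&0\\0&-\mathbb I_2\end{pmatrix}$ and $\alpha_k=\begin{pmatrix}0&\sigma_k\\ \sigma_k&0\end{pmatrix}$, $k=1,2,3$, where $\sigma_k$ are the Pauli matrices, and let $D=i\,\boldsymbol\alpha\cdot\nabla-\beta$ on $L^2(\mathbb R^3;\mathbb C^4)$. With $\hat u(p)=(2\pi)^{-3/2}\int e^{-ip\cdot x}u(x)\,dx$ it is multiplication by $\hat D(p)=-(\boldsymbol\alpha\cdot p+\beta)$, which has the eigenvalues $\pm\lambda(p)$, $\lambda(p)=\sqrt{|p|^2+1}$. Let $\Lambda_\pm$ be the orthogonal projectors onto the positive and negative spectral subspaces of $D$, that is, multiplication of $\hat u(p)$ by $\tfrac12(\mathbb I_4\pm\hat D(p)/\lambda(p))$; write $\psi_\pm=\Lambda_\pm\psi$, $X_+=\Lambda_+H^{1/2}(\mathbb R^3;\mathbb C^4)$, and $\|u\|_{H^{1/2}}^2=\int_{\mathbb R^3}\sqrt{|p|^2+1}\,|\hat u(p)|^2\,dp$. Let $\mathrm e\in\mathbb R$ be a charge with $\mathrm e\neq0$ and $\mathrm e^2\,\tfrac{\pi}{2}<\tfrac1{87}$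 (satisfied by the fine structure constant $\mathrm e^2\approx\frac1{137}$). For $m\in(0,1]$ and $\psi\in H^{1/2}(\mathbb R^3;\mathbb C^4)$ put $$\mathcal I^{(m)}(\psi)=\|\psi_+\|_{H^{1/2}}^2-\|\psi_-\|_{H^{1/2}}^2-m\,\frac{\mathrm e^2}{2}\int_{\mathbb R^3\times\mathbb R^3}\frac{\rho_\psi(x)\rho_\psi(y)-J_\psi(x)\cdot J_\psi(y)}{|x-y|}\,dx\,dy,$$ where $\rho_\psi=|\psi|^2$ and $J_\psi=(\psi,\boldsymbol\alpha\psi)_{\mathbb C^4}$. Define $$e(m)=\inf_{\substack{W\subset X_+\\ \dim_{\mathbb C}W=1}}\ \sup_{\psi\in\mathcal X_W}\mathcal I^{(m)}(\psi),\qquad \mathcal X_W=\{\psi\in H^{1/2}(\mathbb R^3;\mathbb C^4):\ \|\psi\|_{L^2}^2=1,\ \psi_+\in W\},$$ and $E(m)=m\,e(m)$. Then $E$ is strictly subadditive: for every $m\in(0,1]$ and all $m_1,m_2\in(0,1)$ with $m_1+m_2=m$, $$E(m)<E(m_1)+E(m_2).$$ -/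

import Mathlib

open MeasureTheory FourierTransform TemperedDistribution
open scoped ENNReal SchwartzMap

noncomputable section

namespace MaxwellDirac

/-- Physical space `ℝ³` (also used for the momentum variable). -/
abbrev R3 : Type := EuclideanSpace ℝ (Fin 3)

/-- The spinor space `ℂ⁴` with its Hermitian scalar product. -/
abbrev Spinor : Type := EuclideanSpace ℂ (Fin 4)

/-- `L²(ℝ³; ℂ⁴)`. -/
abbrev L2 : Type := Lp Spinor 2 (volume : Measure R3)

/-- The Dirac matrix `β = diag(1, 1, -1, -1)`. -/
def diracBeta : Matrix (Fin 4) (Fin 4) ℂ :=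
  !![1, 0, 0, 0;
     0, 1, 0, 0;
     0, 0, -1, 0;
     0, 0, 0, -1]

/-- The Dirac matrices `α_k`, with off-diagonal blocks the Pauli matrix `σ_k` and
zero diagonal blocks, `k = 1, 2, 3`. -/
def diracAlpha : Fin 3 → Matrix (Fin 4) (Fin 4) ℂ :=
  ![!![0, 0, 0, 1;
       0, 0, 1, 0;
       0, 1, 0, 0;
       1, 0, 0, 0],
    !![0, 0, 0, -Complex.I;
       0, 0, Complex.I, 0;
       0, -Complex.I, 0, 0;
       Complex.I, 0, 0, 0],
    !![0, 0, 1, 0;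
       0, 0, 0, -1;
       1, 0, 0, 0;
       0, -1, 0, 0]]

/-- `λ(p) = √(|p|² + 1)`. -/
def lam (p : R3) : ℝ := Real.sqrt (‖p‖ ^ 2 + 1)

/-- The symbol `D̂(p) = -(α · p + β)` of the operator `D = i α · ∇ - β` (mass one). -/
def diracSymbol (p : R3) : Matrix (Fin 4) (Fin 4) ℂ :=
  -(∑ k, (p k : ℂ) • diracAlpha k + diracBeta)

/-- For `ε = 1` and `ε = -1`: the orthogonal projector `(1 + ε D̂(p) / λ(p)) / 2` of `ℂ⁴` onto the
eigenspace of the Hermitian matrix `D̂(p)` for the eigenvalue `ε λ(p)`. -/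
def projSymbol (ε : ℝ) (p : R3) : Matrix (Fin 4) (Fin 4) ℂ :=
  (1 / 2 : ℂ) • (1 + ((ε / lam p : ℝ) : ℂ) • diracSymbol p)

/-- The projector symbol as an operator-valued function of the variable `ξ = p / 2π` that
is dual to `x` for the Fourier transform `𝓕 u (ξ) = ∫ e^{-2πi x·ξ} u(x) dx`. -/
def projFun (ε : ℝ) (ξ : R3) : Spinor →L[ℂ] Spinor :=
  Matrix.toEuclideanCLM (n := Fin 4) (𝕜 := ℂ) (projSymbol ε ((2 * Real.pi) • ξ))

lemma one_le_lam (p : R3) : 1 ≤ lam p := by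
  unfold lam
  rw [Real.one_le_sqrt]
  nlinarith [sq_nonneg ‖p‖]

lemma norm_le_lam (p : R3) : ‖p‖ ≤ lam p := by
  unfold lam
  apply Real.le_sqrt_of_sq_le
  linarith

lemma projFun_eq (ε : ℝ) (ξ : R3) :
    projFun ε ξ = (1 / 2 : ℂ) • (1 + ((ε / lam ((2 * Real.pi) • ξ) : ℝ) : ℂ) •
      (-(∑ k, ((((2 * Real.pi) • ξ) k : ℝ) : ℂ) •
          Matrix.toEuclideanCLM (n := Fin 4) (𝕜 := ℂ) (diracAlpha k) +
        Matrix.toEuclideanCLM (n := Fin 4) (𝕜 := ℂ) diracBeta))) := by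
  simp only [projFun, projSymbol, diracSymbol, map_smul, map_add, map_one, map_neg, map_sum]

lemma continuous_projFun (ε : ℝ) : Continuous (projFun ε) := by
  have hl : Continuous fun ξ : R3 => lam ((2 * Real.pi) • ξ) := by
    unfold lam
    fun_prop
  have hd : Continuous fun ξ : R3 => ((ε / lam ((2 * Real.pi) • ξ) : ℝ) : ℂ) :=
    Complex.continuous_ofReal.comp (continuous_const.div hl fun ξ =>
      (lt_of_lt_of_le one_pos (one_le_lam _)).ne')
  have hk : ∀ k : Fin 3, Continuous fun ξ : R3 => ((((2 * Real.pi) • ξ) k : ℝ) : ℂ) := by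
    intro k
    fun_prop
  rw [show projFun ε = _ from funext (projFun_eq ε)]
  fun_prop

lemma memLp_projFun (ε : ℝ) : MemLp (projFun ε) ∞ (volume : Measure R3) := by
  set T := Matrix.toEuclideanCLM (n := Fin 4) (𝕜 := ℂ)
  refine memLp_top_of_bound (continuous_projFun ε).aestronglyMeasurable
    (1 / 2 * (1 + |ε| * (∑ k, ‖T (diracAlpha k)‖ + ‖T diracBeta‖)))
    (Filter.Eventually.of_forall fun ξ => ?_)
  rw [projFun_eq]
  set p : R3 := (2 * Real.pi) • ξ
  have hl := one_le_lam p
  have hl0 : 0 < lam p := by linarith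
  have hS : ‖-(∑ k, ((p k : ℝ) : ℂ) • T (diracAlpha k) + T diracBeta)‖ ≤
      lam p * (∑ k, ‖T (diracAlpha k)‖ + ‖T diracBeta‖) := by
    rw [norm_neg, mul_add, Finset.mul_sum]
    refine (norm_add_le _ _).trans (add_le_add ((norm_sum_le _ _).trans
      (Finset.sum_le_sum fun k _ => ?_)) ?_)
    · rw [norm_smul, Complex.norm_real]
      exact mul_le_mul_of_nonneg_right ((PiLp.norm_apply_le p k).trans (norm_le_lam p))
        (norm_nonneg _)
    · exact le_mul_of_one_le_left (norm_nonneg _) hl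
  have h1 : ‖(1 : Spinor →L[ℂ] Spinor)‖ ≤ 1 := ContinuousLinearMap.norm_id_le
  rw [norm_smul]
  have h2 : ‖(1 / 2 : ℂ)‖ = 1 / 2 := by norm_num
  rw [h2]
  refine mul_le_mul_of_nonneg_left ((norm_add_le _ _).trans (add_le_add h1 ?_)) (by norm_num)
  rw [norm_smul, Complex.norm_real, Real.norm_eq_abs, abs_div, abs_of_pos hl0]
  calc |ε| / lam p * _ ≤ |ε| / lam p *
        (lam p * (∑ k, ‖T (diracAlpha k)‖ + ‖T diracBeta‖)) :=
        mul_le_mul_of_nonneg_left hS (by positivity)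
    _ = |ε| * (∑ k, ‖T (diracAlpha k)‖ + ‖T diracBeta‖) := by
        field_simp

/-- The spectral projectors `Λ_±(D)` on `L²(ℝ³; ℂ⁴)`, for `ε = ±1`: the Fourier multiplier
`𝓕⁻¹ (1 + ε D̂(p) / λ(p)) / 2 𝓕`, `p = 2π ξ`. -/
def spectralProj (ε : ℝ) : L2 →ₗ[ℂ] L2 :=
  ((Lp.fourierTransformₗᵢ R3 Spinor).symm.toLinearEquiv : L2 →ₗ[ℂ] L2) ∘ₗ
    (ContinuousLinearMap.holderₗ volume ∞ 2 2
      (ContinuousLinearMap.id ℂ (Spinor →L[ℂ] Spinor)) ((memLp_projFun ε).toLp (projFun ε))) ∘ₗ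
    ((Lp.fourierTransformₗᵢ R3 Spinor).toLinearEquiv : L2 →ₗ[ℂ] L2)

/-- `Λ_+(D)`. -/
abbrev projPlus : L2 →ₗ[ℂ] L2 := spectralProj 1

/-- `Λ_-(D)`. -/
abbrev projMinus : L2 →ₗ[ℂ] L2 := spectralProj (-1)

/-- The Sobolev space `H^{1/2}(ℝ³; ℂ⁴)`, as a subspace of `L²(ℝ³; ℂ⁴)`. -/
def HHalf : Submodule ℂ L2 where
  carrier := {u | MemSobolev (1 / 2) 2 (Lp.toTemperedDistributionCLM Spinor volume 2 u)}
  add_mem' {u v} hu hv := by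
    simp only [Set.mem_ofPred_eq, map_add] at *
    exact MemSobolev.add hu hv
  zero_mem' := by
    simp only [Set.mem_ofPred_eq, map_zero]
    exact memSobolev_fun_zero R3 Spinor _ _
  smul_mem' c u hu := by
    simp only [Set.mem_ofPred_eq, map_smul] at *
    exact MemSobolev.smul c hu

/-- `‖u‖²_{H^{1/2}} = ∫ √(|p|² + 1) |û(p)|² dp` with the unitary Fourier transform
`û(p) = (2π)^{-3/2} ∫ e^{-ip·x} u(x) dx`, written in the variable `ξ = p / 2π`
(`û(p) = (2π)^{-3/2} 𝓕 u (p / 2π)`, `dp = (2π)³ dξ`). -/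
def normSqHHalf (u : L2) : ℝ :=
  ∫ ξ : R3, lam ((2 * Real.pi) • ξ) * ‖(𝓕 u : L2) ξ‖ ^ 2

/-- `X_+(D) = Λ_+(D) H^{1/2}(ℝ³; ℂ⁴)`. -/
def XPlus : Submodule ℂ L2 := HHalf.map projPlus

/-- The density `ρ_ψ = |ψ|²`. -/
def rho (ψ : L2) (x : R3) : ℝ := ‖ψ x‖ ^ 2

/-- The current `J_ψ = (ψ, α ψ)`; each component is real because `α_k` is Hermitian. -/
def current (ψ : L2) (k : Fin 3) (x : R3) : ℝ :=
  (inner ℂ (ψ x) (Matrix.toEuclideanCLM (n := Fin 4) (𝕜 := ℂ) (diracAlpha k) (ψ x))).re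

/-- `∬ (ρ_ψ(x) ρ_ψ(y) - J_ψ(x) · J_ψ(y)) / |x - y| dx dy`. -/
def interaction (ψ : L2) : ℝ :=
  ∫ z : R3 × R3, (rho ψ z.1 * rho ψ z.2 - ∑ k, current ψ k z.1 * current ψ k z.2) / ‖z.1 - z.2‖

/-- The functional `I^{(m)}` with charge `e`. -/
def functional (e m : ℝ) (ψ : L2) : ℝ :=
  normSqHHalf (projPlus ψ) - normSqHHalf (projMinus ψ) - m * (e ^ 2 / 2) * interaction ψ

/-- The sphere `Σ` of `L²`-normalized elements of `H^{1/2}`. -/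
def Sphere : Set L2 := {ψ | ψ ∈ HHalf ∧ ‖ψ‖ ^ 2 = 1}

/-- `𝒳_W = {ψ ∈ Σ : ψ_+ ∈ W}`. -/
def XW (W : Submodule ℂ L2) : Set L2 := {ψ | ψ ∈ Sphere ∧ projPlus ψ ∈ W}

/-- The inf-sup level `e(m) = inf_{W ⊂ X_+(D), dim W = 1} sup_{ψ ∈ 𝒳_W} I^{(m)}(ψ)`, the infimum
and the suprema being taken in the extended reals. -/
def level (e m : ℝ) : EReal :=
  ⨅ (W : Submodule ℂ L2) (_ : W ≤ XPlus ∧ Module.finrank ℂ W = 1),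
    ⨆ ψ ∈ XW W, ((functional e m ψ : ℝ) : EReal)

/-- `E(m) = m e(m)`. -/
def energyLevel (e m : ℝ) : EReal := (m : EReal) * level e m

end MaxwellDirac

end

noncomputable section

namespace MaxwellDirac

/-! Since `E(m) = m₁ e(m) + m₂ e(m)`, the theorem follows once `e(m) < e(m')` whenever `0 ≤ m' < m`.
Lowering `m` raises the functional by `(m - m') e²/2` times the interaction of `ψ`, but this gain
may degenerate in two ways.

On a fixed line `W = ℂφ`, some `ψ ∈ 𝒳_W` may have a small interaction. By a Kato inequality the
square root of the interaction is stable in `H^{1/2}`, so such a `ψ` has a large negative-energy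
part. This part lowers the functional so much that `ψ` is beaten by `φ` itself. Hence the supremum
over `𝒳_W` drops by a fixed fraction of the interaction of `φ` (`functional_le_max_sub`).

As `W` varies, the interaction of `φ` may tend to zero. Then the functional at `φ` is nearly at
least `1`, the rest mass, so such lines are irrelevant if the level at `m` is below `1`
(`exists_lt_le_level`). This binding (`level_lt_one`) is tested on a slowly varying state at rest:
with momentum spread `η` the kinetic excess is `O(η²)` and the interaction is at least of order `η`.

No sharp constant is needed: Kato's inequality with constant `3` in place of `π/2` suffices for the
given bound on the charge. -/

/-! ### The Fourier transform on `L²` -/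

open scoped ContDiff in
/-- Locally integrable functions that agree as tempered distributions agree almost everywhere. -/
lemma ae_eq_of_integral_schwartz_smul_eq {f g : R3 → Spinor} (hf : LocallyIntegrable f)
    (hg : LocallyIntegrable g)
    (h : ∀ s : 𝓢(R3, ℂ), ∫ x, s x • f x = ∫ x, s x • g x) : f =ᵐ[volume] g := by
  refine ae_eq_of_integral_contDiff_smul_eq hf hg fun s hs hc => ?_
  have hg₁ : HasCompactSupport (Complex.ofRealCLM ∘ s) := hc.comp_left rfl
  have hg₂ : ContDiff ℝ ∞ (Complex.ofRealCLM ∘ s) := by fun_prop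
  simpa using h (hg₁.toSchwartzMap hg₂)

/-- On integrable functions the inverse Fourier transform of `L²` is given by the integral. -/
lemma coeFn_fourierInv_of_integrable (g : L2) (hg : Integrable g) :
    (𝓕⁻ g : L2) =ᵐ[volume] (𝓕⁻ (g : R3 → Spinor) : R3 → Spinor) := by
  have hcont : Continuous (𝓕⁻ (g : R3 → Spinor) : R3 → Spinor) :=
    VectorFourier.fourierIntegral_continuous Real.continuous_fourierChar
      (continuous_inner (𝕜 := ℝ) (E := R3)).neg hg
  refine ae_eq_of_integral_schwartz_smul_eq ((Lp.memLp _).locallyIntegrable (by norm_num))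
    hcont.locallyIntegrable fun s => ?_
  have h1 : ∫ x, s x • (𝓕⁻ g : L2) x = ∫ x, (𝓕⁻ s) x • g x := by
    have := congrArg (fun T : 𝓢'(R3, Spinor) => T s) (Lp.fourierInv_toTemperedDistribution_eq g)
    simpa only [Lp.toTemperedDistribution_apply, TemperedDistribution.fourierInv_apply] using
      this.symm
  rw [h1]
  have h2 := VectorFourier.integral_fourierIntegral_smul_eq_flip (μ := volume) (ν := volume)
    (L := -innerₗ R3) (f := (s : R3 → ℂ)) (g := (g : R3 → Spinor)) (e := Real.fourierChar)
    Real.continuous_fourierChar (continuous_inner (𝕜 := ℝ) (E := R3)).neg s.integrable hg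
  rw [SchwartzMap.fourierInv_coe]
  have h3 : (-innerₗ R3).flip = -innerₗ R3 := by
    ext x y
    simp [real_inner_comm]
  rw [h3] at h2
  exact h2

/-! ### The `H^{1/2}` energy in Fourier variables -/

/-- `‖u‖²_{H^{1/2}}` as an extended nonnegative real. -/
def sobolevEnergy (u : L2) : ℝ≥0∞ :=
  ∫⁻ ξ : R3, ENNReal.ofReal (lam ((2 * Real.pi) • ξ)) * ‖(𝓕 u : L2) ξ‖ₑ ^ 2

/-- The Fourier weight defining membership in `H^{1/2}`. -/
def sobolevWeight (ξ : R3) : ℝ := (1 + ‖ξ‖ ^ 2) ^ ((1 / 2 : ℝ) / 2)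

lemma continuous_lam : Continuous lam := by
  unfold lam
  fun_prop

lemma continuous_sobolevWeight : Continuous sobolevWeight :=
  ((continuous_norm.pow 2).const_add 1).rpow_const fun ξ =>
    Or.inl (by have := sq_nonneg ‖ξ‖; simp only [Pi.pow_apply]; linarith)

lemma sobolevWeight_sq (ξ : R3) : sobolevWeight ξ ^ 2 = Real.sqrt (1 + ‖ξ‖ ^ 2) := by
  rw [sobolevWeight, ← Real.rpow_natCast, ← Real.rpow_mul (by positivity), Real.sqrt_eq_rpow]
  norm_num

lemma sobolevWeight_sq_le (ξ : R3) : sobolevWeight ξ ^ 2 ≤ lam ((2 * Real.pi) • ξ) := by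
  rw [sobolevWeight_sq, lam, norm_smul, Real.norm_of_nonneg (by positivity)]
  apply Real.sqrt_le_sqrt
  have : 1 ≤ 2 * Real.pi := by linarith [Real.pi_gt_three]
  nlinarith [mul_le_mul_of_nonneg_right this (norm_nonneg ξ), norm_nonneg ξ]

lemma lam_le_sobolevWeight_sq (ξ : R3) :
    lam ((2 * Real.pi) • ξ) ≤ 2 * Real.pi * sobolevWeight ξ ^ 2 := by
  rw [sobolevWeight_sq, lam, norm_smul, Real.norm_of_nonneg (by positivity)]
  have : 1 ≤ 2 * Real.pi := by linarith [Real.pi_gt_three]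
  rw [Real.sqrt_le_left (by positivity), mul_pow, mul_pow (2 * Real.pi) (Real.sqrt _),
    Real.sq_sqrt (by positivity)]
  nlinarith

/-- The Sobolev weight `(1 + |ξ|²)^{1/4}` and `λ(2πξ)^{1/2}` differ by bounded factors only: the
norms differ, the space is the same. -/
lemma memLp_sobolevWeight_smul_iff (u : L2) :
    MemLp (fun ξ => sobolevWeight ξ • (𝓕 u : L2) ξ) 2 ↔ sobolevEnergy u < ⊤ := by
  have hm : AEStronglyMeasurable (fun ξ => sobolevWeight ξ • (𝓕 u : L2) ξ) volume :=
    continuous_sobolevWeight.aestronglyMeasurable.smul (Lp.aestronglyMeasurable _)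
  have heq : ∫⁻ ξ, ‖sobolevWeight ξ • (𝓕 u : L2) ξ‖ₑ ^ (2 : ℝ≥0∞).toReal =
      ∫⁻ ξ, ENNReal.ofReal (sobolevWeight ξ ^ 2) * ‖(𝓕 u : L2) ξ‖ₑ ^ 2 := by
    refine lintegral_congr fun ξ => ?_
    rw [ENNReal.toReal_ofNat, ENNReal.rpow_ofNat, enorm_smul, mul_pow,
      Real.enorm_eq_ofReal (by unfold sobolevWeight; positivity),
      ENNReal.ofReal_pow (by unfold sobolevWeight; positivity)]
  unfold MemLp
  rw [and_iff_right hm, eLpNorm_lt_top_iff_lintegral_rpow_enorm_lt_top (by norm_num) (by norm_num),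
    heq]
  constructor
  · intro h
    have hle : sobolevEnergy u ≤ ENNReal.ofReal (2 * Real.pi) *
        ∫⁻ ξ, ENNReal.ofReal (sobolevWeight ξ ^ 2) * ‖(𝓕 u : L2) ξ‖ₑ ^ 2 := by
      rw [← lintegral_const_mul' _ _ ENNReal.ofReal_ne_top]
      refine lintegral_mono fun ξ => ?_
      rw [← mul_assoc, ← ENNReal.ofReal_mul (by positivity)]
      gcongr
      exact lam_le_sobolevWeight_sq ξ
    exact hle.trans_lt (ENNReal.mul_lt_top ENNReal.ofReal_lt_top h)
  · refine fun h => lt_of_le_of_lt (lintegral_mono fun ξ => ?_) h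
    gcongr
    exact sobolevWeight_sq_le ξ

/-- `u ∈ H^{1/2}` if and only if `∫ λ(p) |û(p)|² dp < ∞`. -/
lemma mem_HHalf_iff (u : L2) : u ∈ HHalf ↔ sobolevEnergy u < ⊤ := by
  rw [← memLp_sobolevWeight_smul_iff]
  have hg : Function.HasTemperateGrowth (fun x : R3 =>
      (((1 + ‖x‖ ^ 2) ^ ((1 / 2 : ℝ) / 2) : ℝ) : ℂ)) := by fun_prop
  have key : ∀ s : 𝓢(R3, ℂ), smulLeftCLM Spinor (fun x : R3 =>
      (((1 + ‖x‖ ^ 2) ^ ((1 / 2 : ℝ) / 2) : ℝ) : ℂ))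
        (𝓕 (Lp.toTemperedDistributionCLM Spinor volume 2 u)) s =
      ∫ ξ, s ξ • (sobolevWeight ξ • (𝓕 u : L2) ξ) := by
    intro s
    rw [Lp.toTemperedDistributionCLM_apply, Lp.fourier_toTemperedDistribution_eq,
      smulLeftCLM_apply_apply, Lp.toTemperedDistribution_apply]
    refine integral_congr_ae (.of_forall fun ξ => ?_)
    simp only [SchwartzMap.smulLeftCLM_apply_apply hg]
    rw [smul_eq_mul, mul_comm, mul_smul, Complex.coe_smul]
    rfl
  change MemSobolev (1 / 2) 2 (Lp.toTemperedDistributionCLM Spinor volume 2 u) ↔ _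
  rw [memSobolev_iff_exists_smulLeftCLM_fourier]
  constructor
  · rintro ⟨f', hf'⟩
    refine (memLp_congr_ae ?_).2 (Lp.memLp f')
    refine ae_eq_of_integral_schwartz_smul_eq ?_
      ((Lp.memLp _).locallyIntegrable (by norm_num)) fun s => ?_
    · rw [← locallyIntegrableOn_univ]
      exact (((Lp.memLp (𝓕 u : L2)).locallyIntegrable (by norm_num)).locallyIntegrableOn _
        ).continuousOn_smul isOpen_univ.isLocallyClosed continuous_sobolevWeight.continuousOn
    · rw [← key, hf', Lp.toTemperedDistribution_apply]
  · intro h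
    refine ⟨h.toLp _, ?_⟩
    ext s : 1
    rw [key, Lp.toTemperedDistribution_apply]
    refine integral_congr_ae ?_
    filter_upwards [h.coeFn_toLp] with ξ hξ
    rw [hξ]

/-! ### A Kato-type inequality by splitting momenta -/

lemma lintegral_enorm_sq_eq (f : L2) : ∫⁻ x, ‖f x‖ₑ ^ 2 = ‖f‖ₑ ^ 2 := by
  rw [Lp.enorm_def, eLpNorm_eq_lintegral_rpow_enorm_toReal (by norm_num) (by norm_num),
    ENNReal.toReal_ofNat, one_div, ← ENNReal.rpow_natCast, ← ENNReal.rpow_mul]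
  norm_num

lemma lintegral_fourier_enorm_sq_eq (f : L2) : ∫⁻ x, ‖(𝓕 f : L2) x‖ₑ ^ 2 = ‖f‖ₑ ^ 2 := by
  rw [lintegral_enorm_sq_eq, ← ofReal_norm, Lp.norm_fourier_eq, ofReal_norm]

/-- The Cauchy-Schwarz inequality for the Lebesgue integral. -/
lemma sq_lintegral_mul_le {α : Type*} [MeasurableSpace α] (μ : Measure α) {f g : α → ℝ≥0∞}
    (hf : AEMeasurable f μ) (hg : AEMeasurable g μ) :
    (∫⁻ a, f a * g a ∂μ) ^ 2 ≤ (∫⁻ a, f a ^ 2 ∂μ) * ∫⁻ a, g a ^ 2 ∂μ := by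
  have h := ENNReal.lintegral_mul_le_Lp_mul_Lq μ (p := 2) (q := 2)
    (Real.holderConjugate_iff.2 (by norm_num)) hf hg
  calc (∫⁻ a, f a * g a ∂μ) ^ 2 ≤ _ := pow_le_pow_left₀ zero_le h 2
    _ = _ := by
      rw [mul_pow, ← ENNReal.rpow_natCast, ← ENNReal.rpow_natCast, ← ENNReal.rpow_mul,
        ← ENNReal.rpow_mul]
      norm_num

lemma lintegral_ball_norm_inv_sq {r : ℝ} (hr : 0 < r) :
    ∫⁻ ξ in Metric.ball (0 : R3) r, ENNReal.ofReal (‖ξ‖⁻¹ ^ 2) =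
      ENNReal.ofReal (4 * Real.pi * r) := by
  have hint : IntegrableOn (fun y : ℝ => y ^ (Module.finrank ℝ R3 - 1) • y⁻¹ ^ 2)
      (Set.Ioo 0 r) := by
    have : IntegrableOn (fun _ : ℝ => (1 : ℝ)) (Set.Ioo 0 r) := by simp
    refine this.congr_fun (fun y hy => ?_) measurableSet_Ioo
    have := hy.1.ne'
    simp [this]
  have hI := (integrableOn_fun_norm_addHaar (volume : Measure R3) (f := fun y : ℝ => y⁻¹ ^ 2)
    (r := r)).2 hint
  rw [← ofReal_integral_eq_lintegral_ofReal hI (.of_forall fun ξ => by positivity)]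
  congr 1
  rw [← integral_indicator measurableSet_ball]
  have h1 : ((Metric.ball (0 : R3) r).indicator fun ξ => ‖ξ‖⁻¹ ^ 2) =
      fun ξ => (Set.Iio r).indicator (fun y : ℝ => y⁻¹ ^ 2) ‖ξ‖ := by
    ext ξ
    simp [Set.indicator]
  rw [h1, integral_fun_norm_addHaar]
  have h2 : ∫ y in Set.Ioi (0 : ℝ), y ^ (Module.finrank ℝ R3 - 1) •
      (Set.Iio r).indicator (fun y : ℝ => y⁻¹ ^ 2) y = r := by
    have h3 : ∫ y in Set.Ioi (0 : ℝ), y ^ (Module.finrank ℝ R3 - 1) •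
        (Set.Iio r).indicator (fun y : ℝ => y⁻¹ ^ 2) y =
        ∫ y in Set.Ioi (0 : ℝ), (Set.Iio r).indicator (fun _ : ℝ => (1 : ℝ)) y := by
      refine setIntegral_congr_fun measurableSet_Ioi fun y hy => ?_
      have : y ≠ 0 := ne_of_gt hy
      by_cases hyr : y < r <;> simp [hyr, this]
    rw [h3, setIntegral_indicator measurableSet_Iio, Set.Ioi_inter_Iio]
    simp [hr.le]
  rw [h2, Measure.real, EuclideanSpace.volume_ball_fin_three]
  rw [ENNReal.toReal_mul, ENNReal.toReal_pow, ENNReal.toReal_ofReal zero_le_one,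
    ENNReal.toReal_ofReal (by positivity)]
  simp
  ring

lemma enorm_fourierInv_le (g : L2) (hg : Integrable g) :
    ∀ᵐ x, ‖(𝓕⁻ g : L2) x‖ₑ ≤ ∫⁻ ξ, ‖g ξ‖ₑ := by
  filter_upwards [coeFn_fourierInv_of_integrable g hg] with x hx
  rw [hx, Real.fourierInv_eq]
  refine (enorm_integral_le_lintegral_enorm _).trans_eq (lintegral_congr fun ξ => ?_)
  rw [← ofReal_norm, Circle.norm_smul, ofReal_norm]

/-- Restriction of an `L²` function to a measurable set. -/
def truncate (s : Set R3) (hs : MeasurableSet s) (g : L2) : L2 :=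
  ((Lp.memLp g).indicator hs).toLp _

lemma coeFn_truncate (s : Set R3) (hs : MeasurableSet s) (g : L2) :
    truncate s hs g =ᵐ[volume] s.indicator g :=
  MemLp.coeFn_toLp _

lemma integrable_truncate (s : Set R3) (hs : MeasurableSet s) (hv : volume s < ⊤) (g : L2) :
    Integrable (truncate s hs g) := by
  rw [integrable_congr (coeFn_truncate s hs g), integrable_indicator_iff hs]
  have : IsFiniteMeasure (volume.restrict s) := ⟨by simpa using hv⟩
  exact ((Lp.memLp g).restrict s).integrable (by norm_num)

/-- The kernel of the momentum-space bound for the mass of a function in a ball of radius `1/t`. -/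
def ballKernel (t : ℝ) (ξ : R3) : ℝ≥0∞ :=
  if 2 * Real.pi * ‖ξ‖ < t then ENNReal.ofReal (8 * Real.pi / 3 * ‖ξ‖ ^ 2 * t⁻¹ ^ 2) else 1

lemma measurable_ballKernel : Measurable (Function.uncurry ballKernel) := by
  unfold ballKernel Function.uncurry
  refine Measurable.ite (measurableSet_lt (by fun_prop) (by fun_prop)) (by fun_prop) (by fun_prop)

/-- Cauchy-Schwarz is applied to `|ξ|⁻¹ · |ξ||g|`. The unweighted version would leave a kernel that
does not decay in `t`; the weight produces the factor `t⁻²` in `ballKernel`, integrable at infinity.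
-/
lemma sq_lintegral_ball_enorm_le (g : L2) {r : ℝ} (hr : 0 < r) :
    (∫⁻ ξ in Metric.ball (0 : R3) r, ‖g ξ‖ₑ) ^ 2 ≤ ENNReal.ofReal (4 * Real.pi * r) *
      ∫⁻ ξ in Metric.ball (0 : R3) r, ENNReal.ofReal (‖ξ‖ ^ 2) * ‖g ξ‖ₑ ^ 2 := by
  have hg : AEMeasurable (fun ξ => ‖g ξ‖ₑ) (volume.restrict (Metric.ball (0 : R3) r)) :=
    (Lp.aestronglyMeasurable g).enorm.restrict
  have h0 : ∀ᵐ ξ ∂(volume.restrict (Metric.ball (0 : R3) r)), ξ ≠ 0 :=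
    ae_restrict_of_ae (by simp [ae_iff])
  calc (∫⁻ ξ in Metric.ball (0 : R3) r, ‖g ξ‖ₑ) ^ 2
      = (∫⁻ ξ in Metric.ball (0 : R3) r,
          ENNReal.ofReal ‖ξ‖⁻¹ * (ENNReal.ofReal ‖ξ‖ * ‖g ξ‖ₑ)) ^ 2 := by
        congr 1
        refine lintegral_congr_ae ?_
        filter_upwards [h0] with ξ hξ
        rw [← mul_assoc, ← ENNReal.ofReal_mul (by positivity),
          inv_mul_cancel₀ (norm_ne_zero_iff.2 hξ), ENNReal.ofReal_one, one_mul]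
    _ ≤ (∫⁻ ξ in Metric.ball (0 : R3) r, ENNReal.ofReal ‖ξ‖⁻¹ ^ 2) *
          ∫⁻ ξ in Metric.ball (0 : R3) r, (ENNReal.ofReal ‖ξ‖ * ‖g ξ‖ₑ) ^ 2 :=
        sq_lintegral_mul_le _ (by fun_prop) (by fun_prop)
    _ = _ := by
        rw [← lintegral_ball_norm_inv_sq hr]
        congr 1
        · refine lintegral_congr fun ξ => ?_
          rw [ENNReal.ofReal_pow (by positivity)]
        · refine lintegral_congr fun ξ => ?_
          rw [mul_pow, ENNReal.ofReal_pow (by positivity)]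

/-- The momenta are split at `|p| = t`. The low part is bounded in the supremum norm and multiplied
by the volume of the ball; the high part is bounded by Plancherel. The factor `2` comes from `(a +
b)² ≤ 2a² + 2b²`. -/
lemma lintegral_ball_enorm_sq_le (u : L2) (y : R3) {t : ℝ} (ht : 0 < t) :
    ∫⁻ x in Metric.ball y t⁻¹, ‖u x‖ₑ ^ 2 ≤ 2 * ∫⁻ ξ, ballKernel t ξ * ‖(𝓕 u : L2) ξ‖ₑ ^ 2 := by
  set r : ℝ := t / (2 * Real.pi) with hr
  have hr0 : 0 < r := by positivity
  set B := Metric.ball (0 : R3) r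
  have hB : MeasurableSet B := measurableSet_ball
  set v : L2 := 𝓕⁻ (truncate B hB (𝓕 u)) with hv
  set w : L2 := 𝓕⁻ (truncate Bᶜ hB.compl (𝓕 u)) with hw
  have hsum : u = v + w := by
    rw [hv, hw, ← FourierTransform.fourierInv_add]
    have : truncate B hB (𝓕 u) + truncate Bᶜ hB.compl (𝓕 u) = 𝓕 u := by
      apply Lp.ext
      filter_upwards [Lp.coeFn_add (truncate B hB (𝓕 u)) (truncate Bᶜ hB.compl (𝓕 u)),
        coeFn_truncate B hB (𝓕 u), coeFn_truncate Bᶜ hB.compl (𝓕 u)] with ξ h1 h2 h3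
      rw [h1, Pi.add_apply, h2, h3]
      exact congrFun (Set.indicator_self_add_compl B _) ξ
    rw [this, FourierTransform.fourierInv_fourier_eq]
  have hlow : ∫⁻ x in Metric.ball y t⁻¹, ‖v x‖ₑ ^ 2 ≤
      ∫⁻ ξ in B, ballKernel t ξ * ‖(𝓕 u : L2) ξ‖ₑ ^ 2 := by
    have hI : ∫⁻ ξ, ‖truncate B hB (𝓕 u) ξ‖ₑ = ∫⁻ ξ in B, ‖(𝓕 u : L2) ξ‖ₑ := by
      rw [← lintegral_indicator hB]
      refine lintegral_congr_ae ?_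
      filter_upwards [coeFn_truncate B hB (𝓕 u)] with ξ h
      rw [h, enorm_indicator_eq_indicator_enorm]
    calc ∫⁻ x in Metric.ball y t⁻¹, ‖v x‖ₑ ^ 2
        ≤ ∫⁻ x in Metric.ball y t⁻¹, (∫⁻ ξ in B, ‖(𝓕 u : L2) ξ‖ₑ) ^ 2 := by
          refine lintegral_mono_ae (ae_restrict_of_ae ?_)
          filter_upwards [enorm_fourierInv_le (truncate B hB (𝓕 u))
            (integrable_truncate B hB measure_ball_lt_top _)] with x hx
          rw [hI] at hx
          gcongr
      _ = (∫⁻ ξ in B, ‖(𝓕 u : L2) ξ‖ₑ) ^ 2 * volume (Metric.ball y t⁻¹) := by simp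
      _ ≤ (ENNReal.ofReal (4 * Real.pi * r) *
          ∫⁻ ξ in B, ENNReal.ofReal (‖ξ‖ ^ 2) * ‖(𝓕 u : L2) ξ‖ₑ ^ 2) *
            volume (Metric.ball y t⁻¹) := by
          gcongr
          exact sq_lintegral_ball_enorm_le _ hr0
      _ = ENNReal.ofReal (8 * Real.pi / 3 * t⁻¹ ^ 2) *
          ∫⁻ ξ in B, ENNReal.ofReal (‖ξ‖ ^ 2) * ‖(𝓕 u : L2) ξ‖ₑ ^ 2 := by
          rw [EuclideanSpace.volume_ball_fin_three, mul_right_comm,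
            ← ENNReal.ofReal_pow (by positivity), ← ENNReal.ofReal_mul (by positivity),
            ← ENNReal.ofReal_mul (by positivity)]
          congr 2
          rw [hr]
          field_simp
          ring
      _ = ∫⁻ ξ in B, ballKernel t ξ * ‖(𝓕 u : L2) ξ‖ₑ ^ 2 := by
          rw [← lintegral_const_mul' _ _ ENNReal.ofReal_ne_top]
          refine setLIntegral_congr_fun hB fun ξ hξ => ?_
          have hξ' : 2 * Real.pi * ‖ξ‖ < t := by
            rw [mem_ball_zero_iff, hr, lt_div_iff₀ (by positivity)] at hξ
            linarith
          simp only [ballKernel, if_pos hξ']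
          rw [← mul_assoc, ← ENNReal.ofReal_mul (by positivity)]
          congr 2
          ring
  have hhigh : ∫⁻ x in Metric.ball y t⁻¹, ‖w x‖ₑ ^ 2 ≤
      ∫⁻ ξ in Bᶜ, ballKernel t ξ * ‖(𝓕 u : L2) ξ‖ₑ ^ 2 := by
    calc ∫⁻ x in Metric.ball y t⁻¹, ‖w x‖ₑ ^ 2 ≤ ∫⁻ x, ‖w x‖ₑ ^ 2 := setLIntegral_le_lintegral _ _
      _ = ∫⁻ ξ, ‖truncate Bᶜ hB.compl (𝓕 u) ξ‖ₑ ^ 2 := by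
          rw [lintegral_enorm_sq_eq, ← lintegral_fourier_enorm_sq_eq, hw,
            FourierTransform.fourier_fourierInv_eq]
      _ = ∫⁻ ξ in Bᶜ, ballKernel t ξ * ‖(𝓕 u : L2) ξ‖ₑ ^ 2 := by
          rw [← lintegral_indicator hB.compl]
          refine lintegral_congr_ae ?_
          filter_upwards [coeFn_truncate Bᶜ hB.compl (𝓕 u)] with ξ h
          rw [h, enorm_indicator_eq_indicator_enorm]
          by_cases hξ : ξ ∈ Bᶜ
          · have hξ' : ¬ 2 * Real.pi * ‖ξ‖ < t := by
              rw [Set.mem_compl_iff, mem_ball_zero_iff, hr, lt_div_iff₀ (by positivity)] at hξ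
              linarith
            simp [hξ, ballKernel, hξ']
          · simp [hξ]
  calc ∫⁻ x in Metric.ball y t⁻¹, ‖u x‖ₑ ^ 2
      ≤ ∫⁻ x in Metric.ball y t⁻¹, (2 * ‖v x‖ₑ ^ 2 + 2 * ‖w x‖ₑ ^ 2) := by
        refine lintegral_mono_ae (ae_restrict_of_ae ?_)
        rw [hsum]
        filter_upwards [Lp.coeFn_add v w] with x hx
        rw [hx, Pi.add_apply]
        calc ‖v x + w x‖ₑ ^ 2 ≤ (‖v x‖ₑ + ‖w x‖ₑ) ^ 2 := by gcongr; exact enorm_add_le _ _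
          _ ≤ _ := by
            rw [← mul_add]
            have := ENNReal.rpow_add_le_mul_rpow_add_rpow ‖v x‖ₑ ‖w x‖ₑ (p := 2) (by norm_num)
            norm_num at this
            exact this
    _ = 2 * (∫⁻ x in Metric.ball y t⁻¹, ‖v x‖ₑ ^ 2) +
          2 * ∫⁻ x in Metric.ball y t⁻¹, ‖w x‖ₑ ^ 2 := by
        rw [lintegral_add_left' , lintegral_const_mul' _ _ (by norm_num),
          lintegral_const_mul' _ _ (by norm_num)]
        exact ((Lp.aestronglyMeasurable v).enorm.pow_const 2).const_mul 2 |>.restrict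
    _ ≤ 2 * (∫⁻ ξ in B, ballKernel t ξ * ‖(𝓕 u : L2) ξ‖ₑ ^ 2) +
          2 * ∫⁻ ξ in Bᶜ, ballKernel t ξ * ‖(𝓕 u : L2) ξ‖ₑ ^ 2 := by gcongr
    _ = _ := by rw [← mul_add, lintegral_add_compl _ hB]

/-- For `ξ ≠ 0`, with `c = |p| = 2π‖ξ‖`, the range `t ≤ c` contributes `c` and the range `t > c`
contributes `4‖ξ‖/3`, which is at most `c/2`. -/
lemma lintegral_ballKernel_le (ξ : R3) :
    ∫⁻ t in Set.Ioi (0 : ℝ), ballKernel t ξ ≤ ENNReal.ofReal (3 / 2 * (2 * Real.pi * ‖ξ‖)) := by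
  set c := 2 * Real.pi * ‖ξ‖ with hc
  rcases eq_or_ne ξ 0 with h0 | h0
  · have : ∫⁻ t in Set.Ioi (0 : ℝ), ballKernel t ξ = 0 := by
      rw [setLIntegral_congr_fun (g := fun _ => 0) measurableSet_Ioi fun t ht => ?_, lintegral_zero]
      have : (0 : ℝ) < t := ht
      simp [ballKernel, h0, this]
    simp [this]
  · have hξ : 0 < ‖ξ‖ := norm_pos_iff.2 h0
    have hc0 : 0 < c := by positivity
    rw [← Set.Ioc_union_Ioi_eq_Ioi hc0.le, lintegral_union measurableSet_Ioi
      (Set.Ioc_disjoint_Ioi le_rfl)]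
    have h1 : ∫⁻ t in Set.Ioc 0 c, ballKernel t ξ = ENNReal.ofReal c := by
      calc _ = ∫⁻ t in Set.Ioc 0 c, 1 := setLIntegral_congr_fun measurableSet_Ioc fun t ht => by
            simp [ballKernel, ← hc, ht.2]
        _ = _ := by simp
    have hi : IntegrableOn (fun t : ℝ => t ^ (-2 : ℝ)) (Set.Ioi c) :=
      integrableOn_Ioi_rpow_of_lt (by norm_num) hc0
    have h2 : ∫⁻ t in Set.Ioi c, ballKernel t ξ =
        ENNReal.ofReal (8 * Real.pi / 3 * ‖ξ‖ ^ 2 * c⁻¹) := by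
      calc _ = ∫⁻ t in Set.Ioi c, ENNReal.ofReal (8 * Real.pi / 3 * ‖ξ‖ ^ 2 * t ^ (-2 : ℝ)) := by
            refine setLIntegral_congr_fun measurableSet_Ioi fun t ht => ?_
            have ht' : c < t := ht
            have ht0 : 0 < t := hc0.trans ht'
            simp only [ballKernel, ← hc, if_pos ht']
            rw [Real.rpow_neg ht0.le, Real.rpow_ofNat, inv_pow]
        _ = _ := by
            rw [← ofReal_integral_eq_lintegral_ofReal (hi.const_mul _), integral_const_mul,
              integral_Ioi_rpow_of_lt (by norm_num) hc0]
            · norm_num [Real.rpow_neg_one]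
            · filter_upwards [ae_restrict_mem measurableSet_Ioi] with t ht
              have ht0 : 0 < t := hc0.trans ht
              positivity
    rw [h1, h2, ← ENNReal.ofReal_add hc0.le (by positivity)]
    apply ENNReal.ofReal_le_ofReal
    have h3 : 8 * Real.pi / 3 * ‖ξ‖ ^ 2 * c⁻¹ = 4 / 3 * ‖ξ‖ := by
      rw [hc]
      field_simp
      ring
    rw [h3, hc]
    nlinarith [Real.pi_gt_three]

/-- Layer-cake formula: for `x ≠ y`, a positive `t` satisfies `x ∈ B(y, 1/t)` exactly when `t < 1/|x
- y|`. At `x = y` the left side is `0` by the convention for inverses. -/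
lemma ofReal_inv_norm_sub_le (x y : R3) :
    ENNReal.ofReal ‖x - y‖⁻¹ ≤
      ∫⁻ t in Set.Ioi (0 : ℝ), (Metric.ball y t⁻¹).indicator (fun _ => 1) x := by
  rcases eq_or_ne x y with h | h
  · simp [h]
  · have hd : 0 < ‖x - y‖ := norm_pos_iff.2 (sub_ne_zero.2 h)
    calc ENNReal.ofReal ‖x - y‖⁻¹ = ∫⁻ t in Set.Ioo 0 ‖x - y‖⁻¹, 1 := by simp
      _ = ∫⁻ t in Set.Ioo 0 ‖x - y‖⁻¹, (Metric.ball y t⁻¹).indicator (fun _ => 1) x := by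
          refine setLIntegral_congr_fun measurableSet_Ioo fun t ht => ?_
          have : x ∈ Metric.ball y t⁻¹ := by
            rw [mem_ball_iff_norm]
            exact (lt_inv_comm₀ ht.1 hd).1 ht.2
          simp [this]
      _ ≤ _ := lintegral_mono_set Set.Ioo_subset_Ioi_self

/-- A Kato type inequality: the Coulomb potential is bounded by `3 √(|p|² + 1)`. -/
lemma lintegral_coulomb_le (u : L2) (y : R3) :
    ∫⁻ x, ‖u x‖ₑ ^ 2 * ENNReal.ofReal ‖x - y‖⁻¹ ≤ 3 * sobolevEnergy u := by
  have hm : AEMeasurable (fun x => ‖u x‖ₑ ^ 2) volume :=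
    (Lp.aestronglyMeasurable u).enorm.pow_const 2
  have hm' : AEMeasurable (fun x => ‖(𝓕 u : L2) x‖ₑ ^ 2) volume :=
    (Lp.aestronglyMeasurable _).enorm.pow_const 2
  have hset : MeasurableSet {z : R3 × ℝ | z.1 ∈ Metric.ball y z.2⁻¹} := by
    simp only [Metric.mem_ball]
    exact measurableSet_lt (by fun_prop) (by fun_prop)
  have hind : Measurable (Function.uncurry fun (x : R3) (t : ℝ) =>
      (Metric.ball y t⁻¹).indicator (fun _ => (1 : ℝ≥0∞)) x) := by
    have : (Function.uncurry fun (x : R3) (t : ℝ) =>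
      (Metric.ball y t⁻¹).indicator (fun _ => (1 : ℝ≥0∞)) x) =
      {z : R3 × ℝ | z.1 ∈ Metric.ball y z.2⁻¹}.indicator fun _ => 1 := by
      ext z
      simp [Set.indicator, Function.uncurry]
    rw [this]
    exact measurable_const.indicator hset
  -- The Coulomb potential is a superposition of balls; each ball is bounded in momentum space
  -- uniformly in `y`, and integration in `t` gives `2 · 3/2 = 3`.
  calc ∫⁻ x, ‖u x‖ₑ ^ 2 * ENNReal.ofReal ‖x - y‖⁻¹
      ≤ ∫⁻ x, ∫⁻ t in Set.Ioi (0 : ℝ),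
          ‖u x‖ₑ ^ 2 * (Metric.ball y t⁻¹).indicator (fun _ => 1) x := by
        refine lintegral_mono fun x => ?_
        rw [lintegral_const_mul' _ _ (by simp)]
        gcongr
        exact ofReal_inv_norm_sub_le x y
    _ = ∫⁻ t in Set.Ioi (0 : ℝ), ∫⁻ x,
          ‖u x‖ₑ ^ 2 * (Metric.ball y t⁻¹).indicator (fun _ => 1) x := by
        refine lintegral_lintegral_swap ?_
        exact hm.comp_fst.mul hind.aemeasurable
    _ ≤ ∫⁻ t in Set.Ioi (0 : ℝ), 2 * ∫⁻ ξ, ballKernel t ξ * ‖(𝓕 u : L2) ξ‖ₑ ^ 2 := by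
        refine setLIntegral_mono' measurableSet_Ioi fun t ht => ?_
        refine le_trans (le_of_eq ?_) (lintegral_ball_enorm_sq_le u y ht)
        rw [← lintegral_indicator measurableSet_ball]
        refine lintegral_congr fun x => ?_
        by_cases hx : x ∈ Metric.ball y t⁻¹ <;> simp [hx]
    _ = 2 * ∫⁻ ξ, ∫⁻ t in Set.Ioi (0 : ℝ), ballKernel t ξ * ‖(𝓕 u : L2) ξ‖ₑ ^ 2 := by
        rw [lintegral_const_mul' _ _ (by norm_num), lintegral_lintegral_swap]
        exact measurable_ballKernel.aemeasurable.mul hm'.comp_snd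
    _ ≤ 2 * ∫⁻ ξ, ENNReal.ofReal (3 / 2) *
          (ENNReal.ofReal (lam ((2 * Real.pi) • ξ)) * ‖(𝓕 u : L2) ξ‖ₑ ^ 2) := by
        gcongr with ξ
        rw [lintegral_mul_const' _ _ (by simp), ← mul_assoc]
        gcongr
        rw [← ENNReal.ofReal_mul (by norm_num)]
        refine (lintegral_ballKernel_le ξ).trans (ENNReal.ofReal_le_ofReal ?_)
        have := norm_le_lam ((2 * Real.pi) • ξ)
        rw [norm_smul, Real.norm_of_nonneg (by positivity)] at this
        linarith
    _ = 3 * sobolevEnergy u := by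
        rw [lintegral_const_mul' _ _ ENNReal.ofReal_ne_top, ← mul_assoc, sobolevEnergy]
        congr 1
        rw [← ENNReal.ofReal_ofNat, ← ENNReal.ofReal_mul (by norm_num)]
        norm_num

/-! ### Pointwise algebra of densities and currents -/

/-- The current `(a, α_k a)` of a spinor. -/
def spinCurrent (a : Spinor) (k : Fin 3) : ℝ :=
  (inner ℂ a (Matrix.toEuclideanCLM (n := Fin 4) (𝕜 := ℂ) (diracAlpha k) a)).re

/-- The interaction `|a|² |b|² - J_a · J_b` of two spinors. -/
def spinForm (a b : Spinor) : ℝ :=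
  ‖a‖ ^ 2 * ‖b‖ ^ 2 - ∑ k, spinCurrent a k * spinCurrent b k

lemma spinForm_comm (a b : Spinor) : spinForm a b = spinForm b a := by
  simp only [spinForm, mul_comm]

/-- The current of a spinor is bounded by its density. -/
lemma sum_spinCurrent_sq_le (a : Spinor) : ∑ k, spinCurrent a k ^ 2 ≤ (‖a‖ ^ 2) ^ 2 := by
  have hn : ‖a‖ ^ 2 = ∑ i, ((a i).re ^ 2 + (a i).im ^ 2) := by
    rw [EuclideanSpace.norm_sq_eq]
    refine Finset.sum_congr rfl fun i _ => ?_
    rw [Complex.sq_norm, Complex.normSq_apply]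
    ring
  have h : ∀ k, spinCurrent a k =
      (∑ i, (starRingEnd ℂ (a i)) * (∑ j, diracAlpha k i j * a j)).re := by
    intro k
    rw [spinCurrent, EuclideanSpace.inner_eq_star_dotProduct]
    simp [dotProduct, Matrix.mulVec, mul_comm]
  rw [hn]
  simp only [h, Fin.sum_univ_three, Fin.sum_univ_four]
  simp [diracAlpha]
  -- Fierz identity: `ρ² - |J|² = (a, βa)² + 4 (Im(ā₀a₂ + ā₁a₃))²`.
  nlinarith [sq_nonneg ((a 0).re ^ 2 + (a 0).im ^ 2 + (a 1).re ^ 2 + (a 1).im ^ 2 -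
    ((a 2).re ^ 2 + (a 2).im ^ 2) - ((a 3).re ^ 2 + (a 3).im ^ 2)),
    sq_nonneg ((a 0).re * (a 2).im - (a 0).im * (a 2).re + (a 1).re * (a 3).im -
      (a 1).im * (a 3).re)]

lemma abs_sum_spinCurrent_le (a b : Spinor) :
    |∑ k, spinCurrent a k * spinCurrent b k| ≤ ‖a‖ ^ 2 * ‖b‖ ^ 2 := by
  refine abs_le_of_sq_le_sq ?_ (by positivity)
  calc _ ≤ (∑ k, spinCurrent a k ^ 2) * ∑ k, spinCurrent b k ^ 2 :=
        Finset.sum_mul_sq_le_sq_mul_sq _ _ _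
    _ ≤ (‖a‖ ^ 2) ^ 2 * (‖b‖ ^ 2) ^ 2 := by
        gcongr
        · exact sum_spinCurrent_sq_le a
        · exact sum_spinCurrent_sq_le b
    _ = _ := by ring

lemma spinForm_nonneg (a b : Spinor) : 0 ≤ spinForm a b := by
  have := abs_le.1 (abs_sum_spinCurrent_le a b)
  unfold spinForm
  linarith

lemma spinForm_le (a b : Spinor) : spinForm a b ≤ 2 * (‖a‖ ^ 2 * ‖b‖ ^ 2) := by
  have := abs_le.1 (abs_sum_spinCurrent_le a b)
  unfold spinForm
  linarith

lemma spinForm_smul_left (c : ℂ) (a b : Spinor) : spinForm (c • a) b = ‖c‖ ^ 2 * spinForm a b := by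
  have h : ∀ k, spinCurrent (c • a) k = ‖c‖ ^ 2 * spinCurrent a k := by
    intro k
    rw [spinCurrent, map_smul, inner_smul_left, inner_smul_right, ← mul_assoc,
      ← Complex.normSq_eq_conj_mul_self, Complex.re_ofReal_mul, Complex.normSq_eq_norm_sq,
      spinCurrent]
  simp only [spinForm, h, norm_smul, mul_sub, Finset.mul_sum]
  congr 1
  · ring
  · exact Finset.sum_congr rfl fun k _ => by ring

lemma spinForm_smul_right (c : ℂ) (a b : Spinor) :
    spinForm a (c • b) = ‖c‖ ^ 2 * spinForm a b := by
  rw [spinForm_comm, spinForm_smul_left, spinForm_comm]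

/-- A nonnegative sesquilinear form satisfies the triangle inequality. -/
lemma sqrt_re_inner_add_le {E : Type*} [NormedAddCommGroup E] [InnerProductSpace ℂ E]
    (A : E →L[ℂ] E) (hA : ∀ a, 0 ≤ (inner ℂ a (A a)).re) (a b : E) :
    √(inner ℂ (a + b) (A (a + b))).re ≤ √(inner ℂ a (A a)).re + √(inner ℂ b (A b)).re := by
  set p := (inner ℂ a (A b)).re + (inner ℂ b (A a)).re with hp
  have hexp : ∀ t : ℝ, (inner ℂ (a + (t : ℂ) • b) (A (a + (t : ℂ) • b))).re =
      (inner ℂ b (A b)).re * (t * t) + p * t + (inner ℂ a (A a)).re := by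
    intro t
    simp only [map_add, map_smul, inner_add_left, inner_add_right, inner_smul_left,
      inner_smul_right, Complex.conj_ofReal, Complex.add_re, Complex.re_ofReal_mul, hp]
    ring
  have hd := discrim_le_zero (a := (inner ℂ b (A b)).re) (b := p) (c := (inner ℂ a (A a)).re)
    fun t => (hexp t) ▸ hA _
  have h1 := hexp 1
  simp only [Complex.ofReal_one, one_smul, mul_one] at h1
  rw [Real.sqrt_le_left (by positivity), h1, add_sq, Real.sq_sqrt (hA a), Real.sq_sqrt (hA b)]
  have h2 : p ≤ 2 * √(inner ℂ a (A a)).re * √(inner ℂ b (A b)).re := by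
    refine le_of_abs_le (abs_le_of_sq_le_sq ?_ (by positivity))
    rw [mul_pow, mul_pow, Real.sq_sqrt (hA a), Real.sq_sqrt (hA b)]
    unfold discrim at hd
    linarith
  linarith

/-- For fixed `b`, `spinForm · b` is the quadratic form of `|b|² - J_b · α`, which is nonnegative,
so its square root is a seminorm. -/
lemma sqrt_spinForm_sub_le (a a' b : Spinor) :
    √(spinForm (a - a') b) ≤ √(spinForm a b) + √(spinForm a' b) := by
  set A : Spinor →L[ℂ] Spinor := ((‖b‖ ^ 2 : ℝ) : ℂ) • 1 -
    ∑ k, ((spinCurrent b k : ℝ) : ℂ) • Matrix.toEuclideanCLM (n := Fin 4) (𝕜 := ℂ) (diracAlpha k)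
    with hA
  have h : ∀ c, (inner ℂ c (A c)).re = spinForm c b := by
    intro c
    rw [hA, sub_apply, inner_sub_right, sum_apply, inner_sum, Complex.sub_re, Complex.re_sum]
    simp only [smul_apply, one_apply_eq_self, inner_smul_right,
      Complex.re_ofReal_mul, spinForm, spinCurrent]
    congr 1
    · rw [mul_comm]
      exact congrArg (· * _) (inner_self_eq_norm_sq (𝕜 := ℂ) c)
    · exact Finset.sum_congr rfl fun k _ => mul_comm _ _
  have h1 := sqrt_re_inner_add_le A (fun c => (h c) ▸ spinForm_nonneg c b) a ((-1 : ℂ) • a')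
  rw [h, h, h, spinForm_smul_left] at h1
  simpa [sub_eq_add_neg] using h1

/-! ### The interaction energy on `H^{1/2}` -/

/-- The mutual interaction energy of two spinor fields. -/
def coulombForm (u v : L2) : ℝ≥0∞ :=
  ∫⁻ z : R3 × R3, ENNReal.ofReal (spinForm (u z.1) (v z.2) / ‖z.1 - z.2‖)

lemma measurable_coeFn (u : L2) : Measurable u := (Lp.stronglyMeasurable u).measurable

lemma continuous_spinForm : Continuous (Function.uncurry spinForm) := by
  unfold Function.uncurry spinForm spinCurrent
  fun_prop

lemma measurable_coulombForm_integrand (u v : L2) :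
    Measurable fun z : R3 × R3 => spinForm (u z.1) (v z.2) / ‖z.1 - z.2‖ :=
  (continuous_spinForm.measurable.comp (((measurable_coeFn u).comp measurable_fst).prodMk
    ((measurable_coeFn v).comp measurable_snd))).div (by fun_prop)

lemma interaction_eq_toReal (ψ : L2) : interaction ψ = (coulombForm ψ ψ).toReal := by
  rw [interaction, coulombForm]
  exact integral_eq_lintegral_of_nonneg_ae
    (.of_forall fun z => div_nonneg (spinForm_nonneg _ _) (norm_nonneg _))
    (measurable_coulombForm_integrand ψ ψ).aestronglyMeasurable

lemma interaction_nonneg (ψ : L2) : 0 ≤ interaction ψ := by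
  rw [interaction_eq_toReal]
  exact ENNReal.toReal_nonneg

lemma coulombForm_comm (u v : L2) : coulombForm u v = coulombForm v u := by
  rw [coulombForm, coulombForm, Measure.volume_eq_prod, ← lintegral_prod_swap]
  refine lintegral_congr fun z => ?_
  rw [spinForm_comm, norm_sub_rev]
  rfl

lemma coulombForm_smul (c : ℂ) (u : L2) :
    coulombForm (c • u) (c • u) = ENNReal.ofReal (‖c‖ ^ 4) * coulombForm u u := by
  rw [coulombForm, coulombForm, ← lintegral_const_mul' _ _ ENNReal.ofReal_ne_top]
  refine lintegral_congr_ae ?_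
  filter_upwards [Measure.quasiMeasurePreserving_fst.ae (Lp.coeFn_smul c u),
    Measure.quasiMeasurePreserving_snd.ae (Lp.coeFn_smul c u)] with z h1 h2
  rw [h1, h2, Pi.smul_apply, Pi.smul_apply, spinForm_smul_left, spinForm_smul_right,
    ← ENNReal.ofReal_mul (by positivity)]
  congr 1
  ring

/-- The Kato bound is uniform in `y`, so it can be integrated against `|v(y)|²`; only `u` needs
regularity. The constant is `2 · 3`, the `2` coming from `spinForm_le`. -/
lemma coulombForm_le (u v : L2) : coulombForm u v ≤ 6 * ‖v‖ₑ ^ 2 * sobolevEnergy u := by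
  have hv : Measurable fun x => ‖v x‖ₑ ^ 2 := (measurable_coeFn v).enorm.pow_const 2
  have hu : Measurable fun x => ‖u x‖ₑ ^ 2 := (measurable_coeFn u).enorm.pow_const 2
  have hm : Measurable fun z : R3 × R3 =>
      2 * ‖v z.2‖ₑ ^ 2 * (‖u z.1‖ₑ ^ 2 * ENNReal.ofReal ‖z.1 - z.2‖⁻¹) :=
    ((hv.comp measurable_snd).const_mul 2).mul ((hu.comp measurable_fst).mul (by fun_prop))
  calc coulombForm u v
      ≤ ∫⁻ z : R3 × R3, 2 * ‖v z.2‖ₑ ^ 2 * (‖u z.1‖ₑ ^ 2 * ENNReal.ofReal ‖z.1 - z.2‖⁻¹) := by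
        refine lintegral_mono fun z => ?_
        calc ENNReal.ofReal (spinForm (u z.1) (v z.2) / ‖z.1 - z.2‖)
            ≤ ENNReal.ofReal (2 * (‖u z.1‖ ^ 2 * ‖v z.2‖ ^ 2) / ‖z.1 - z.2‖) := by
              gcongr
              exact spinForm_le _ _
          _ = _ := by
              rw [div_eq_mul_inv, ENNReal.ofReal_mul (by positivity),
                ENNReal.ofReal_mul (by positivity), ENNReal.ofReal_mul (by positivity),
                ENNReal.ofReal_pow (by positivity), ENNReal.ofReal_pow (by positivity),
                ofReal_norm, ofReal_norm, ENNReal.ofReal_ofNat]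
              ring
    _ = ∫⁻ y, ∫⁻ x, 2 * ‖v y‖ₑ ^ 2 * (‖u x‖ₑ ^ 2 * ENNReal.ofReal ‖x - y‖⁻¹) :=
        lintegral_prod_symm' _ hm
    _ ≤ ∫⁻ y, ‖v y‖ₑ ^ 2 * (6 * sobolevEnergy u) := by
        refine lintegral_mono fun y => ?_
        rw [lintegral_const_mul' _ _ (ENNReal.mul_ne_top (by norm_num) (by simp))]
        calc _ ≤ 2 * ‖v y‖ₑ ^ 2 * (3 * sobolevEnergy u) := by
              gcongr
              exact lintegral_coulomb_le u y
          _ = _ := by ring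
    _ = 6 * ‖v‖ₑ ^ 2 * sobolevEnergy u := by
        rw [lintegral_mul_const _ hv, lintegral_enorm_sq_eq]
        ring

lemma coulombForm_lt_top {u : L2} (hu : u ∈ HHalf) (v : L2) : coulombForm u v < ⊤ :=
  (coulombForm_le u v).trans_lt (ENNReal.mul_lt_top (ENNReal.mul_lt_top (by norm_num) (by simp))
    ((mem_HHalf_iff u).1 hu))

/-- Minkowski's inequality in `L²(ℝ³ × ℝ³)` for the square root of the integrand, which is
subadditive pointwise by `sqrt_spinForm_sub_le`. -/
lemma coulombForm_sub_rpow_le (u u' v : L2) :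
    coulombForm (u - u') v ^ (1 / 2 : ℝ) ≤
      coulombForm u v ^ (1 / 2 : ℝ) + coulombForm u' v ^ (1 / 2 : ℝ) := by
  set f : L2 → R3 × R3 → ℝ≥0∞ := fun w z =>
    ENNReal.ofReal √(spinForm (w z.1) (v z.2) / ‖z.1 - z.2‖) with hf
  have hfm : ∀ w, Measurable (f w) := fun w =>
    (measurable_coulombForm_integrand w v).sqrt.ennreal_ofReal
  have hfs : ∀ w, coulombForm w v = ∫⁻ z, f w z ^ (2 : ℝ) := by
    intro w
    refine lintegral_congr fun z => ?_
    rw [hf, ENNReal.rpow_ofNat, ← ENNReal.ofReal_pow (by positivity),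
      Real.sq_sqrt (div_nonneg (spinForm_nonneg _ _) (norm_nonneg _))]
  rw [hfs, hfs, hfs]
  refine le_trans ?_ (ENNReal.lintegral_Lp_add_le (hfm u).aemeasurable (hfm u').aemeasurable
    (by norm_num : (1 : ℝ) ≤ 2))
  refine ENNReal.rpow_le_rpow (lintegral_mono_ae ?_) (by norm_num)
  filter_upwards [Measure.quasiMeasurePreserving_fst.ae (Lp.coeFn_sub u u')] with z h1
  refine ENNReal.rpow_le_rpow ?_ (by norm_num)
  rw [hf, Pi.add_apply]
  simp only
  rw [h1, Pi.sub_apply, ← ENNReal.ofReal_add (by positivity) (by positivity)]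
  refine ENNReal.ofReal_le_ofReal ?_
  simp only [Real.sqrt_div (spinForm_nonneg _ _), ← add_div]
  gcongr
  exact sqrt_spinForm_sub_le _ _ _

lemma normSqHHalf_eq_toReal (u : L2) : normSqHHalf u = (sobolevEnergy u).toReal := by
  rw [normSqHHalf, sobolevEnergy, integral_eq_lintegral_of_nonneg_ae]
  · congr 1
    refine lintegral_congr fun ξ => ?_
    rw [ENNReal.ofReal_mul (zero_le_one.trans (one_le_lam _)), ENNReal.ofReal_pow (norm_nonneg _),
      ofReal_norm]
  · exact .of_forall fun ξ => mul_nonneg (zero_le_one.trans (one_le_lam _)) (by positivity)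
  · exact ((continuous_lam.comp (continuous_const_smul _)).measurable.mul
      ((measurable_coeFn _).norm.pow_const 2)).aestronglyMeasurable

lemma normSqHHalf_nonneg (u : L2) : 0 ≤ normSqHHalf u := by
  rw [normSqHHalf_eq_toReal]
  exact ENNReal.toReal_nonneg

lemma norm_sq_le_normSqHHalf {u : L2} (hu : u ∈ HHalf) : ‖u‖ ^ 2 ≤ normSqHHalf u := by
  rw [normSqHHalf_eq_toReal, ← ENNReal.ofReal_le_iff_le_toReal ((mem_HHalf_iff u).1 hu).ne,
    ENNReal.ofReal_pow (norm_nonneg _), ofReal_norm, ← lintegral_fourier_enorm_sq_eq]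
  refine lintegral_mono fun ξ => ?_
  refine le_mul_of_one_le_left zero_le ?_
  rw [← ENNReal.ofReal_one]
  exact ENNReal.ofReal_le_ofReal (one_le_lam _)

lemma toReal_coulombForm_le {u : L2} (hu : u ∈ HHalf) (v : L2) :
    (coulombForm u v).toReal ≤ 6 * ‖v‖ ^ 2 * normSqHHalf u := by
  have h := ENNReal.toReal_mono (ENNReal.mul_ne_top (ENNReal.mul_ne_top (by norm_num) (by simp))
    ((mem_HHalf_iff u).1 hu).ne) (coulombForm_le u v)
  simpa [ENNReal.toReal_mul, normSqHHalf_eq_toReal] using h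

lemma interaction_le {u : L2} (hu : u ∈ HHalf) :
    interaction u ≤ 6 * ‖u‖ ^ 2 * normSqHHalf u := by
  rw [interaction_eq_toReal]
  exact toReal_coulombForm_le hu u

lemma interaction_smul (c : ℂ) (u : L2) : interaction (c • u) = ‖c‖ ^ 4 * interaction u := by
  rw [interaction_eq_toReal, interaction_eq_toReal, coulombForm_smul, ENNReal.toReal_mul,
    ENNReal.toReal_ofReal (by positivity)]

lemma sqrt_toReal_coulombForm_sub_le {u u' : L2} (hu : u ∈ HHalf) (hu' : u' ∈ HHalf) (v : L2) :
    √(coulombForm (u - u') v).toReal ≤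
      √(coulombForm u v).toReal + √(coulombForm u' v).toReal := by
  have h1 := coulombForm_lt_top hu v
  have h2 := coulombForm_lt_top hu' v
  have h := ENNReal.toReal_mono (ENNReal.add_ne_top.2
    ⟨ENNReal.rpow_ne_top_of_nonneg (by norm_num) h1.ne,
      ENNReal.rpow_ne_top_of_nonneg (by norm_num) h2.ne⟩) (coulombForm_sub_rpow_le u u' v)
  rw [ENNReal.toReal_add (ENNReal.rpow_ne_top_of_nonneg (by norm_num) h1.ne)
    (ENNReal.rpow_ne_top_of_nonneg (by norm_num) h2.ne)] at h
  simpa only [← ENNReal.toReal_rpow, ← Real.sqrt_eq_rpow] using h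

/-- Stability of the interaction energy under perturbations in `H^{1/2}`. -/
lemma sqrt_interaction_sub_le {ψ χ : L2} (hψ : ψ ∈ HHalf) (hχ : χ ∈ HHalf) :
    √(interaction (ψ - χ)) ≤ √(interaction ψ) +
      √6 * (‖ψ - χ‖ + ‖ψ‖) * √(normSqHHalf χ) := by
  have hb : ∀ v : L2, √(coulombForm χ v).toReal ≤ √6 * ‖v‖ * √(normSqHHalf χ) := by
    intro v
    refine (Real.sqrt_le_sqrt (toReal_coulombForm_le hχ v)).trans_eq ?_
    rw [Real.sqrt_mul (by positivity), Real.sqrt_mul (by positivity), Real.sqrt_sq (norm_nonneg _)]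
  -- The interaction is quadratic in each slot: the two slots are changed from `ψ - χ` to `ψ` one at
  -- a time, using symmetry in between.
  have h1 := sqrt_toReal_coulombForm_sub_le hψ hχ (ψ - χ)
  have h2 := sqrt_toReal_coulombForm_sub_le hψ hχ ψ
  rw [coulombForm_comm (ψ - χ) ψ] at h2
  have h3 := hb (ψ - χ)
  have h4 := hb ψ
  rw [interaction_eq_toReal, interaction_eq_toReal]
  linarith

/-! ### The Dirac symbol and the spectral projectors -/

lemma lam_pos (p : R3) : 0 < lam p := zero_lt_one.trans_le (one_le_lam p)

lemma diracSymbol_mul_self (p : R3) :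
    diracSymbol p * diracSymbol p = ((lam p ^ 2 : ℝ) : ℂ) • 1 := by
  have h : lam p ^ 2 = p 0 ^ 2 + p 1 ^ 2 + p 2 ^ 2 + 1 := by
    rw [lam, Real.sq_sqrt (by positivity), EuclideanSpace.norm_sq_eq, Fin.sum_univ_three]
    simp
  rw [h]
  ext i j
  fin_cases i <;> fin_cases j <;>
    simp [diracSymbol, diracAlpha, diracBeta, Matrix.mul_apply, Fin.sum_univ_three,
      Fin.sum_univ_four] <;> ring_nf <;> simp

lemma star_diracSymbol (p : R3) : star (diracSymbol p) = diracSymbol p := by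
  ext i j
  fin_cases i <;> fin_cases j <;>
    simp [diracSymbol, diracAlpha, diracBeta, Matrix.star_apply, Fin.sum_univ_three]

/-- The sign `D̂(p) / λ(p)` of the Dirac symbol, `p = 2π ξ`. -/
def signFun (ξ : R3) : Spinor →L[ℂ] Spinor :=
  Matrix.toEuclideanCLM (n := Fin 4) (𝕜 := ℂ)
    (((lam ((2 * Real.pi) • ξ))⁻¹ : ℂ) • diracSymbol ((2 * Real.pi) • ξ))

lemma signFun_mul_self (ξ : R3) : signFun ξ * signFun ξ = 1 := by
  have h := (lam_pos ((2 * Real.pi) • ξ)).ne'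
  rw [signFun, ← map_mul, Matrix.smul_mul, Matrix.mul_smul, diracSymbol_mul_self, smul_smul,
    smul_smul]
  have : ((lam ((2 * Real.pi) • ξ) : ℂ))⁻¹ * ((lam ((2 * Real.pi) • ξ) : ℂ))⁻¹ *
      ((lam ((2 * Real.pi) • ξ) ^ 2 : ℝ) : ℂ) = 1 := by
    have : (lam ((2 * Real.pi) • ξ) : ℂ) ≠ 0 := by exact_mod_cast h
    push_cast
    field_simp
  rw [this, one_smul, map_one]

lemma star_signFun (ξ : R3) : star (signFun ξ) = signFun ξ := by
  rw [signFun, ← map_star, star_smul, star_diracSymbol]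
  simp

lemma norm_signFun_apply (ξ : R3) (a : Spinor) : ‖signFun ξ a‖ = ‖a‖ := by
  have h : inner ℂ (signFun ξ a) (signFun ξ a) = inner ℂ a a := by
    rw [← ContinuousLinearMap.adjoint_inner_right, ← ContinuousLinearMap.star_eq_adjoint,
      star_signFun]
    change inner ℂ a ((signFun ξ * signFun ξ) a) = _
    rw [signFun_mul_self, one_apply_eq_self]
  have h2 : ‖signFun ξ a‖ ^ 2 = ‖a‖ ^ 2 := by
    rw [← inner_self_eq_norm_sq (𝕜 := ℂ), ← inner_self_eq_norm_sq (𝕜 := ℂ), h]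
  exact (sq_eq_sq₀ (norm_nonneg _) (norm_nonneg _)).1 h2

lemma projFun_eq_signFun (ε : ℝ) (ξ : R3) :
    projFun ε ξ = (1 / 2 : ℂ) • (1 + (ε : ℂ) • signFun ξ) := by
  rw [projFun, projSymbol, signFun, map_smul, map_add, map_one, map_smul, map_smul, smul_smul]
  push_cast
  rfl

lemma projFun_add (ξ : R3) (a : Spinor) : projFun 1 ξ a + projFun (-1) ξ a = a := by
  simp only [projFun_eq_signFun, smul_apply, add_apply, one_apply_eq_self, ← smul_add]
  push_cast
  rw [one_smul, neg_smul, one_smul, add_add_add_comm, add_neg_cancel, add_zero, ← two_smul ℂ a,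
    smul_smul]
  norm_num

lemma projFun_projFun (ε : ℝ) (ξ : R3) (a : Spinor) :
    projFun ε ξ (projFun 1 ξ a) = ((1 + ε) / 2 : ℂ) • projFun 1 ξ a := by
  have h : signFun ξ (signFun ξ a) = a := by
    change (signFun ξ * signFun ξ) a = a
    rw [signFun_mul_self, one_apply_eq_self]
  simp only [projFun_eq_signFun, smul_apply, add_apply, one_apply_eq_self, map_smul, map_add, h,
    Complex.ofReal_one, one_smul]
  module

/-- The projections are `(a ± Sa)/2` with `S = signFun ξ` isometric, so this is the parallelogram
law. -/
lemma norm_sq_projFun_add (ξ : R3) (a : Spinor) :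
    ‖projFun 1 ξ a‖ ^ 2 + ‖projFun (-1) ξ a‖ ^ 2 = ‖a‖ ^ 2 := by
  have h := parallelogram_law_with_norm ℂ a (signFun ξ a)
  rw [norm_signFun_apply] at h
  simp only [projFun_eq_signFun, smul_apply, add_apply, one_apply_eq_self, norm_smul]
  push_cast
  rw [one_smul, neg_smul, one_smul, ← sub_eq_add_neg]
  norm_num
  linarith

lemma norm_sq_projFun_le {ε : ℝ} (hε : ε = 1 ∨ ε = -1) (ξ : R3) (a : Spinor) :
    ‖projFun ε ξ a‖ ^ 2 ≤ ‖a‖ ^ 2 := by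
  have h := norm_sq_projFun_add ξ a
  rcases hε with rfl | rfl
  · nlinarith [sq_nonneg ‖projFun (-1) ξ a‖]
  · nlinarith [sq_nonneg ‖projFun 1 ξ a‖]

/-- A spinor at rest has a negative energy part of second order in the momentum. -/
lemma lam_mul_norm_sq_projFun_single_le (ξ : R3) (c : ℂ) :
    lam ((2 * Real.pi) • ξ) * ‖projFun (-1) ξ (EuclideanSpace.single 2 c)‖ ^ 2 ≤
      ‖(2 * Real.pi) • ξ‖ ^ 2 / 4 * ‖c‖ ^ 2 := by
  set p := (2 * Real.pi) • ξ with hp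
  set a : Spinor := EuclideanSpace.single 2 c with ha
  have hl := lam_pos p
  have hna : ‖a‖ = ‖c‖ := by simp [ha]
  -- The `α_k` are off-diagonal, so only `-β` contributes; it acts as `+1` on the third component.
  -- Thus `a` has positive energy at `p = 0`.
  have h1 : (inner ℂ a (signFun ξ a)).re = (lam p)⁻¹ * ‖c‖ ^ 2 := by
    rw [signFun, ← hp, map_smul, smul_apply, inner_smul_right, ← Complex.ofReal_inv,
      Complex.re_ofReal_mul]
    congr 1
    rw [EuclideanSpace.inner_eq_star_dotProduct]
    simp [ha, dotProduct, Fin.sum_univ_four, Matrix.mulVec, diracSymbol, diracAlpha, diracBeta,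
      Fin.sum_univ_three]
    rw [Complex.sq_norm, Complex.normSq_apply]
  have h2 : ‖projFun (-1) ξ a‖ ^ 2 = (1 - (lam p)⁻¹) / 2 * ‖c‖ ^ 2 := by
    have h3 := norm_sub_sq (𝕜 := ℂ) a (signFun ξ a)
    rw [norm_signFun_apply] at h3
    change _ = _ - 2 * (inner ℂ a (signFun ξ a)).re + _ at h3
    rw [h1, hna] at h3
    simp only [projFun_eq_signFun, smul_apply, add_apply, one_apply_eq_self, norm_smul, mul_pow]
    push_cast
    rw [neg_smul, one_smul, ← sub_eq_add_neg, h3]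
    norm_num
    ring
  rw [h2]
  have h4 : lam p ≤ 1 + ‖p‖ ^ 2 / 2 := by
    rw [lam, Real.sqrt_le_left (by positivity)]
    nlinarith [sq_nonneg (‖p‖ ^ 2)]
  have h5 : lam p * ((1 - (lam p)⁻¹) / 2 * ‖c‖ ^ 2) = (lam p - 1) / 2 * ‖c‖ ^ 2 := by
    field_simp
  rw [h5]
  refine mul_le_mul_of_nonneg_right ?_ (by positivity)
  linarith

lemma coeFn_fourier_spectralProj (ε : ℝ) (u : L2) :
    (𝓕 (spectralProj ε u) : L2) =ᵐ[volume] fun ξ => projFun ε ξ ((𝓕 u : L2) ξ) := by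
  have h : (𝓕 (spectralProj ε u) : L2) = ContinuousLinearMap.holder 2
      (ContinuousLinearMap.id ℂ (Spinor →L[ℂ] Spinor)) ((memLp_projFun ε).toLp (projFun ε))
      (𝓕 u : L2) :=
    (Lp.fourierTransformₗᵢ R3 Spinor).apply_symm_apply _
  rw [h]
  filter_upwards [ContinuousLinearMap.coeFn_holder (r := 2)
    (ContinuousLinearMap.id ℂ (Spinor →L[ℂ] Spinor)) ((memLp_projFun ε).toLp (projFun ε))
    (𝓕 u : L2), (memLp_projFun ε).coeFn_toLp] with ξ h1 h2
  rw [h1, h2]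
  rfl

lemma fourier_injective {u v : L2} (h : (𝓕 u : L2) =ᵐ[volume] (𝓕 v : L2)) : u = v :=
  (Lp.fourierTransformₗᵢ R3 Spinor).injective (Lp.ext h)

lemma projPlus_add_projMinus (u : L2) : projPlus u + projMinus u = u := by
  apply fourier_injective
  rw [FourierTransform.fourier_add]
  filter_upwards [coeFn_fourier_spectralProj 1 u, coeFn_fourier_spectralProj (-1) u,
    Lp.coeFn_add (𝓕 (projPlus u) : L2) (𝓕 (projMinus u) : L2)] with ξ h1 h2 h3
  rw [h3, Pi.add_apply, h1, h2, projFun_add]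

lemma spectralProj_projPlus (ε : ℝ) (u : L2) :
    spectralProj ε (projPlus u) = ((1 + ε) / 2 : ℂ) • projPlus u := by
  apply fourier_injective
  rw [FourierTransform.fourier_smul]
  filter_upwards [coeFn_fourier_spectralProj 1 u, coeFn_fourier_spectralProj ε (projPlus u),
    Lp.coeFn_smul ((1 + ε) / 2 : ℂ) (𝓕 (projPlus u) : L2)] with ξ h1 h2 h3
  rw [h3, Pi.smul_apply, h2, h1, projFun_projFun]

lemma projPlus_projPlus (u : L2) : projPlus (projPlus u) = projPlus u := by
  rw [projPlus, spectralProj_projPlus]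
  norm_num

lemma projMinus_projPlus (u : L2) : projMinus (projPlus u) = 0 := by
  rw [projMinus, spectralProj_projPlus]
  norm_num

lemma sobolevEnergy_spectralProj_le {ε : ℝ} (hε : ε = 1 ∨ ε = -1) (u : L2) :
    sobolevEnergy (spectralProj ε u) ≤ sobolevEnergy u := by
  refine lintegral_mono_ae ?_
  filter_upwards [coeFn_fourier_spectralProj ε u] with ξ h
  rw [h]
  gcongr
  rw [← ofReal_norm, ← ofReal_norm]
  exact ENNReal.ofReal_le_ofReal
    ((sq_le_sq₀ (norm_nonneg _) (norm_nonneg _)).1 (norm_sq_projFun_le hε ξ _))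

lemma spectralProj_mem_HHalf {ε : ℝ} (hε : ε = 1 ∨ ε = -1) {u : L2} (hu : u ∈ HHalf) :
    spectralProj ε u ∈ HHalf := by
  rw [mem_HHalf_iff] at hu ⊢
  exact (sobolevEnergy_spectralProj_le hε u).trans_lt hu

lemma norm_sq_projPlus_add (u : L2) : ‖projPlus u‖ ^ 2 + ‖projMinus u‖ ^ 2 = ‖u‖ ^ 2 := by
  have h : (∫⁻ ξ, ‖(𝓕 (projPlus u) : L2) ξ‖ₑ ^ 2) + ∫⁻ ξ, ‖(𝓕 (projMinus u) : L2) ξ‖ₑ ^ 2 =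
      ∫⁻ ξ, ‖(𝓕 u : L2) ξ‖ₑ ^ 2 := by
    rw [← lintegral_add_left ((measurable_coeFn _).enorm.pow_const 2)]
    refine lintegral_congr_ae ?_
    filter_upwards [coeFn_fourier_spectralProj 1 u, coeFn_fourier_spectralProj (-1) u] with ξ h1 h2
    rw [h1, h2]
    simp only [← ofReal_norm]
    rw [← ENNReal.ofReal_pow (norm_nonneg _), ← ENNReal.ofReal_pow (norm_nonneg _),
      ← ENNReal.ofReal_pow (norm_nonneg _), ← ENNReal.ofReal_add (by positivity) (by positivity),
      norm_sq_projFun_add]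
  simp only [lintegral_fourier_enorm_sq_eq] at h
  have := congrArg ENNReal.toReal h
  simpa [ENNReal.toReal_add] using this

lemma sobolevEnergy_smul (c : ℂ) (u : L2) :
    sobolevEnergy (c • u) = ENNReal.ofReal (‖c‖ ^ 2) * sobolevEnergy u := by
  rw [sobolevEnergy, sobolevEnergy, ← lintegral_const_mul' _ _ ENNReal.ofReal_ne_top,
    FourierTransform.fourier_smul]
  refine lintegral_congr_ae ?_
  filter_upwards [Lp.coeFn_smul c (𝓕 u : L2)] with ξ h
  rw [h, Pi.smul_apply, enorm_smul, ENNReal.ofReal_pow (norm_nonneg _), ofReal_norm]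
  ring

lemma normSqHHalf_smul (c : ℂ) (u : L2) : normSqHHalf (c • u) = ‖c‖ ^ 2 * normSqHHalf u := by
  rw [normSqHHalf_eq_toReal, normSqHHalf_eq_toReal, sobolevEnergy_smul, ENNReal.toReal_mul,
    ENNReal.toReal_ofReal (by positivity)]

/-! ### Strict monotonicity of the level in the coupling -/

/-- The normalized elements of `X_+`. -/
structure IsPositiveState (φ : L2) : Prop where
  mem_HHalf : φ ∈ HHalf
  norm_eq : ‖φ‖ = 1
  projPlus_eq : projPlus φ = φ

lemma IsPositiveState.projMinus_eq {φ : L2} (h : IsPositiveState φ) : projMinus φ = 0 := by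
  rw [← h.projPlus_eq, projMinus_projPlus]

lemma normSqHHalf_zero : normSqHHalf 0 = 0 := by
  have := normSqHHalf_smul 0 0
  simpa using this

lemma IsPositiveState.functional_eq {φ : L2} (h : IsPositiveState φ) (e m : ℝ) :
    functional e m φ = normSqHHalf φ - m * (e ^ 2 / 2) * interaction φ := by
  rw [functional, h.projPlus_eq, h.projMinus_eq, normSqHHalf_zero, sub_zero]

lemma IsPositiveState.one_le_normSqHHalf {φ : L2} (h : IsPositiveState φ) :
    1 ≤ normSqHHalf φ := by
  simpa [h.norm_eq] using norm_sq_le_normSqHHalf h.mem_HHalf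

lemma IsPositiveState.interaction_le {φ : L2} (h : IsPositiveState φ) :
    interaction φ ≤ 6 * normSqHHalf φ := by
  simpa [h.norm_eq] using MaxwellDirac.interaction_le h.mem_HHalf

/-- Lowering the coupling constant raises the functional, uniformly over the states whose positive
energy part is proportional to `φ`. -/
lemma functional_le_max_sub {φ ψ : L2} (hφ : IsPositiveState φ) (hψ : ψ ∈ Sphere) {a : ℂ}
    (ha : projPlus ψ = a • φ) {e m m' : ℝ} (hm' : 0 ≤ m') (hmm : m' ≤ m)
    (hκ : m * (e ^ 2 / 2) ≤ 1 / 261) :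
    functional e m ψ ≤ max (functional e m' ψ) (functional e m' φ) -
      (m - m') * (e ^ 2 / 2) * (interaction φ / 100) := by
  set χ := projMinus ψ with hχ
  have hχH : χ ∈ HHalf := spectralProj_mem_HHalf (Or.inr rfl) hψ.1
  have hsub : ψ - χ = a • φ := by
    rw [← ha, sub_eq_iff_eq_add, projPlus_add_projMinus]
  have hn := norm_sq_projPlus_add ψ
  rw [ha, norm_smul, hφ.norm_eq, mul_one, hψ.2, ← hχ] at hn
  have hnψ : ‖ψ‖ = 1 :=
    (pow_eq_one_iff_of_nonneg (norm_nonneg ψ) two_ne_zero).1 hψ.2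
  have ha1 : ‖a‖ ≤ 1 := by nlinarith [sq_nonneg ‖χ‖, norm_nonneg a]
  have hb := norm_sq_le_normSqHHalf hχH
  have hst := sqrt_interaction_sub_le hψ.1 hχH
  rw [hsub, interaction_smul, norm_smul, hφ.norm_eq, mul_one, hnψ] at hst
  have hF : ∀ m, functional e m ψ = ‖a‖ ^ 2 * normSqHHalf φ - normSqHHalf χ -
      m * (e ^ 2 / 2) * interaction ψ := by
    intro m
    rw [functional, ha, normSqHHalf_smul]
  have hV0 := interaction_nonneg φ
  have hVψ0 := interaction_nonneg ψ
  have hV6 := hφ.interaction_le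
  have hn1 := hφ.one_le_normSqHHalf
  set n := normSqHHalf φ
  set V := interaction φ
  set s := interaction ψ
  set T := normSqHHalf χ
  have he : 0 ≤ e ^ 2 / 2 := by positivity
  have hκ0 : 0 ≤ m * (e ^ 2 / 2) := mul_nonneg (hm'.trans hmm) he
  have hd : 0 ≤ (m - m') * (e ^ 2 / 2) := mul_nonneg (by linarith) he
  -- If the interaction of `ψ` is at least `V/100`, the gain is read off at `ψ`. Otherwise `ψ` is
  -- compared with `φ`, whose interaction is `V`.
  rcases le_or_gt (V / 100) s with h | h
  · have h1 : functional e m ψ ≤ functional e m' ψ - (m - m') * (e ^ 2 / 2) * (V / 100) := by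
      rw [hF, hF]
      nlinarith [mul_le_mul_of_nonneg_left h hd]
    linarith [le_max_left (functional e m' ψ) (functional e m' φ)]
  · have hT0 : 0 ≤ T := (sq_nonneg _).trans hb
    -- This is what makes `φ` beat `ψ`: the loss of positive energy plus the negative energy of `χ`
    -- pays for the whole interaction of `φ`. If `‖χ‖² ≥ 1/2`, the term with `n` suffices because
    -- `6/261 ≤ 1/2`; otherwise stability forces `T` to be large.
    have key : m * (e ^ 2 / 2) * V ≤ ‖χ‖ ^ 2 * n + T := by
      rcases le_or_gt (1 / 2) (‖χ‖ ^ 2) with hb2 | hb2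
      · have h1 : m * (e ^ 2 / 2) * V ≤ 1 / 261 * (6 * n) :=
          mul_le_mul hκ hV6 hV0 (by norm_num)
        nlinarith
      · have h1 : √(‖a‖ ^ 4 * V) = ‖a‖ ^ 2 * √V := by
          rw [show ‖a‖ ^ 4 = (‖a‖ ^ 2) ^ 2 by ring, Real.sqrt_mul (by positivity),
            Real.sqrt_sq (by positivity)]
        have h2 : √s ≤ √V / 10 := by
          rw [Real.sqrt_le_left (by positivity), div_pow, Real.sq_sqrt hV0]
          linarith
        have h3 : √6 * (‖a‖ + 1) * √T ≤ √6 * 2 * √T := by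
          gcongr
          linarith
        have h4 : 2 / 5 * √V ≤ √6 * 2 * √T := by
          rw [h1] at hst
          have : 1 / 2 * √V ≤ ‖a‖ ^ 2 * √V := by
            gcongr
            linarith
          linarith
        -- Squaring gives `V ≤ 150 T`, and `150/261 < 1`.
        have h5 : (2 / 5 * √V) ^ 2 ≤ (√6 * 2 * √T) ^ 2 := by gcongr
        rw [mul_pow, mul_pow, mul_pow, Real.sq_sqrt hV0, Real.sq_sqrt hT0,
          Real.sq_sqrt (by norm_num)] at h5
        have h6 : m * (e ^ 2 / 2) * V ≤ 1 / 261 * (150 * T) :=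
          mul_le_mul hκ (by linarith) hV0 (by norm_num)
        nlinarith [mul_nonneg (sq_nonneg ‖χ‖) (zero_le_one.trans hn1)]
    have h1 : functional e m ψ ≤ functional e m φ := by
      rw [hF, hφ.functional_eq]
      have : ‖a‖ ^ 2 = 1 - ‖χ‖ ^ 2 := by linarith
      rw [this]
      nlinarith [mul_nonneg hκ0 hVψ0]
    have h2 : functional e m φ ≤ functional e m' φ - (m - m') * (e ^ 2 / 2) * (V / 100) := by
      rw [hφ.functional_eq, hφ.functional_eq]
      nlinarith [mul_nonneg hd hV0]
    linarith [le_max_right (functional e m' ψ) (functional e m' φ)]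

lemma exists_isPositiveState {W : Submodule ℂ L2} (hW : W ≤ XPlus)
    (h1 : Module.finrank ℂ W = 1) :
    ∃ φ ∈ W, IsPositiveState φ ∧ ∀ w ∈ W, ∃ a : ℂ, w = a • φ := by
  obtain ⟨⟨v, hv⟩, hv0, hspan⟩ := finrank_eq_one_iff'.1 h1
  have hv0' : v ≠ 0 := fun h => hv0 (by simpa using h)
  have hnv : (‖v‖ : ℂ) ≠ 0 := by simpa using hv0'
  obtain ⟨u, hu, rfl⟩ := hW hv
  refine ⟨(‖projPlus u‖ : ℂ)⁻¹ • projPlus u, W.smul_mem _ hv, ⟨?_, ?_, ?_⟩, fun w hw => ?_⟩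
  · exact HHalf.smul_mem _ (spectralProj_mem_HHalf (Or.inl rfl) hu)
  · rw [norm_smul, norm_inv, Complex.norm_real, norm_norm,
      inv_mul_cancel₀ (norm_ne_zero_iff.2 hv0')]
  · rw [map_smul, projPlus_projPlus]
  · obtain ⟨c, hc⟩ := hspan ⟨w, hw⟩
    refine ⟨c * ‖projPlus u‖, ?_⟩
    rw [smul_smul, mul_assoc, mul_inv_cancel₀ hnv, mul_one]
    exact (congrArg Subtype.val hc).symm

lemma IsPositiveState.mem_XW {φ : L2} (h : IsPositiveState φ) {W : Submodule ℂ L2}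
    (hφ : φ ∈ W) : φ ∈ XW W :=
  ⟨⟨h.mem_HHalf, by rw [h.norm_eq, one_pow]⟩, by rwa [h.projPlus_eq]⟩

lemma IsPositiveState.functional_le_iSup {φ : L2} (h : IsPositiveState φ) {W : Submodule ℂ L2}
    (hφ : φ ∈ W) (e m : ℝ) :
    ((functional e m φ : ℝ) : EReal) ≤ ⨆ ψ ∈ XW W, ((functional e m ψ : ℝ) : EReal) :=
  le_iSup₂ (f := fun ψ (_ : ψ ∈ XW W) => ((functional e m ψ : ℝ) : EReal)) φ (h.mem_XW hφ)

/-- With the upper bound from `level_lt_one` this makes the level a real number. Testing with `φ`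
itself suffices, since its interaction is at most `6` times its energy and `6/261 < 1`. -/
lemma level_nonneg {e m : ℝ} (hκ : m * (e ^ 2 / 2) ≤ 1 / 261) :
    0 ≤ level e m := by
  refine le_iInf₂ fun W hW => ?_
  obtain ⟨φ, hφW, hφ, -⟩ := exists_isPositiveState hW.1 hW.2
  refine le_trans ?_ (hφ.functional_le_iSup hφW e m)
  rw [← EReal.coe_zero, EReal.coe_le_coe_iff, hφ.functional_eq]
  have h1 := hφ.interaction_le
  have h2 := hφ.one_le_normSqHHalf
  nlinarith [mul_le_mul_of_nonneg_right hκ (interaction_nonneg φ)]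

/-- If the level for the mass `m` lies below `1`, it lies strictly below the levels for smaller
masses. -/
lemma exists_lt_le_level {e m m' r : ℝ} (he : e ≠ 0) (hm' : 0 ≤ m') (hmm : m' < m)
    (hκ : m * (e ^ 2 / 2) ≤ 1 / 261) (hr : level e m = r) (hr1 : r < 1) :
    ∃ r' : ℝ, r < r' ∧ (r' : EReal) ≤ level e m' := by
  have he2 : 0 < e ^ 2 / 2 := by positivity
  set d := (m - m') * (e ^ 2 / 2) with hd
  have hd0 : 0 < d := mul_pos (by linarith) he2
  have hκ' : 0 ≤ m' * (e ^ 2 / 2) := by positivity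
  have hsum : m' * (e ^ 2 / 2) + d ≤ 1 / 261 := by rw [hd]; linarith
  refine ⟨r + d * ((1 - r) / 100), by nlinarith [mul_pos hd0 (sub_pos.2 hr1)],
    le_iInf₂ fun W hW => ?_⟩
  obtain ⟨φ, hφW, hφ, hspan⟩ := exists_isPositiveState hW.1 hW.2
  -- If `φ` interacts by at least `1 - r`, the supremum over `𝒳_W` gains a fixed amount. Otherwise
  -- the value at `φ` for the mass `m'` is at least `1 - m'(e²/2)(1 - r)`, which already exceeds `r`
  -- by enough.
  rcases le_or_gt (1 - r) (interaction φ) with h | h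
  · rw [EReal.coe_add]
    refine (EReal.le_sub_iff_add_le (.inl (EReal.coe_ne_bot _)) (.inl (EReal.coe_ne_top _))).1 ?_
    rw [← hr]
    refine iInf₂_le_of_le W hW (iSup₂_le fun ψ hψ => ?_)
    refine (EReal.le_sub_iff_add_le (.inl (EReal.coe_ne_bot _)) (.inl (EReal.coe_ne_top _))).2 ?_
    obtain ⟨a, ha⟩ := hspan _ hψ.2
    have h1 := functional_le_max_sub hφ hψ.1 ha hm' hmm.le hκ
    have h2 : functional e m ψ + d * ((1 - r) / 100) ≤
        max (functional e m' ψ) (functional e m' φ) := by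
      have : d * ((1 - r) / 100) ≤ d * (interaction φ / 100) := by gcongr
      rw [← hd] at h1
      linarith
    rw [← EReal.coe_add]
    refine (EReal.coe_le_coe_iff.2 h2).trans ?_
    rcases le_total (functional e m' ψ) (functional e m' φ) with h3 | h3
    · rw [max_eq_right h3]
      exact hφ.functional_le_iSup hφW e m'
    · rw [max_eq_left h3]
      exact le_iSup₂ (f := fun ψ (_ : ψ ∈ XW W) => ((functional e m' ψ : ℝ) : EReal)) ψ hψ
  · refine le_trans ?_ (hφ.functional_le_iSup hφW e m')
    rw [EReal.coe_le_coe_iff, hφ.functional_eq]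
    have h1 := hφ.one_le_normSqHHalf
    have h2 := mul_le_mul_of_nonneg_left h.le hκ'
    nlinarith [mul_nonneg (sub_nonneg.2 hsum) (sub_pos.2 hr1).le, mul_pos hd0 (sub_pos.2 hr1)]

/-! ### Binding: a trial state with small momentum -/

/-- `functional_le_max_sub` with `m' = 0` controls the whole supremum over the line of `φ`: without
interaction the functional is at most the energy of `φ`. -/
lemma level_lt_one_of_isPositiveState {e m : ℝ} (hm : 0 ≤ m) (hκ : m * (e ^ 2 / 2) ≤ 1 / 261)
    {φ : L2} (hφ : IsPositiveState φ)
    (h : normSqHHalf φ - m * (e ^ 2 / 2) * (interaction φ / 100) < 1) : level e m < 1 := by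
  have hφ0 : φ ≠ 0 := fun h0 => by simpa [h0] using hφ.norm_eq
  have hW : Submodule.span ℂ {φ} ≤ XPlus ∧ Module.finrank ℂ (Submodule.span ℂ {φ}) = 1 := by
    refine ⟨?_, finrank_span_singleton hφ0⟩
    rw [Submodule.span_singleton_le_iff_mem]
    exact ⟨φ, hφ.mem_HHalf, hφ.projPlus_eq⟩
  refine (iInf₂_le_of_le (Submodule.span ℂ {φ}) hW (iSup₂_le fun ψ hψ => ?_)).trans_lt
    (EReal.coe_lt_coe_iff.2 h)
  obtain ⟨a, ha⟩ := Submodule.mem_span_singleton.1 hψ.2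
  have h1 := functional_le_max_sub hφ hψ.1 ha.symm le_rfl hm hκ
  rw [sub_zero] at h1
  refine EReal.coe_le_coe_iff.2 (h1.trans (sub_le_sub_right (max_le ?_ ?_) _))
  · rw [functional, zero_mul, zero_mul, sub_zero, ← ha, normSqHHalf_smul]
    have hn := norm_sq_projPlus_add ψ
    rw [← ha, norm_smul, hφ.norm_eq, mul_one, hψ.1.2] at hn
    nlinarith [normSqHHalf_nonneg (projMinus ψ), sq_nonneg ‖projMinus ψ‖,
      hφ.one_le_normSqHHalf]
  · rw [hφ.functional_eq, zero_mul, zero_mul, sub_zero]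

/-- Normalizing `projPlus u` is harmless: its norm is at most `1`, so the quartic interaction grows
at least as much as the quadratic energy. -/
lemma level_lt_one_of_mem_HHalf {e m : ℝ} (hm : 0 ≤ m) (hκ : m * (e ^ 2 / 2) ≤ 1 / 261)
    {u : L2} (hu : u ∈ HHalf) (h0 : projPlus u ≠ 0) (h1 : ‖u‖ ≤ 1)
    (h : normSqHHalf (projPlus u) - m * (e ^ 2 / 2) * (interaction (projPlus u) / 100) <
      ‖projPlus u‖ ^ 2) : level e m < 1 := by
  set v := projPlus u with hv
  have hnv : 0 < ‖v‖ := norm_pos_iff.2 h0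
  have hv1 : ‖v‖ ≤ 1 := by
    have := norm_sq_projPlus_add u
    nlinarith [sq_nonneg ‖projMinus u‖, norm_nonneg u]
  have hc : ‖((‖v‖ : ℂ))⁻¹‖ = ‖v‖⁻¹ := by simp
  refine level_lt_one_of_isPositiveState hm hκ (φ := (‖v‖ : ℂ)⁻¹ • v) ⟨?_, ?_, ?_⟩ ?_
  · exact HHalf.smul_mem _ (spectralProj_mem_HHalf (Or.inl rfl) hu)
  · rw [norm_smul, hc, inv_mul_cancel₀ hnv.ne']
  · rw [map_smul, hv, projPlus_projPlus]
  · rw [normSqHHalf_smul, interaction_smul, hc]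
    have hκ0 : 0 ≤ m * (e ^ 2 / 2) := by positivity
    have h2 : ‖v‖⁻¹ ^ 2 * interaction v ≤ ‖v‖⁻¹ ^ 4 * interaction v := by
      refine mul_le_mul_of_nonneg_right ?_ (interaction_nonneg v)
      exact pow_le_pow_right₀ ((one_le_inv₀ hnv).2 hv1) (by norm_num)
    have h3 := mul_lt_mul_of_pos_left h (by positivity : 0 < ‖v‖⁻¹ ^ 2)
    rw [← mul_pow, inv_mul_cancel₀ hnv.ne', one_pow] at h3
    nlinarith [mul_le_mul_of_nonneg_left h2 hκ0]

/-- A spinor in the lower block carries no current, so the magnetic term does not reduce the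
repulsion form of the trial state. -/
lemma spinForm_single_self (c : ℂ) :
    spinForm (EuclideanSpace.single 2 c) (EuclideanSpace.single 2 c) = ‖c‖ ^ 4 := by
  have h : ∀ k, spinCurrent (EuclideanSpace.single 2 c) k = 0 := by
    intro k
    rw [spinCurrent, EuclideanSpace.inner_eq_star_dotProduct]
    fin_cases k <;>
      simp [dotProduct, Fin.sum_univ_four, Matrix.mulVec, diracAlpha]
  simp only [spinForm, h, mul_zero, Finset.sum_const_zero, PiLp.norm_single]
  ring

/-- The Fourier integral of the indicator of a ball is large near the origin. -/
lemma norm_integral_fourierChar_ge {r : ℝ} (x : R3) (hx : 2 * Real.pi * r * ‖x‖ ≤ 1) :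
    volume.real (Metric.ball (0 : R3) r) / 2 ≤
      ‖∫ ξ in Metric.ball (0 : R3) r, (Real.fourierChar (inner ℝ ξ x) : ℂ)‖ := by
  have hint : IntegrableOn (fun ξ : R3 => (Real.fourierChar (inner ℝ ξ x) : ℂ))
      (Metric.ball 0 r) := by
    refine Measure.integrableOn_of_bounded (M := 1) measure_ball_lt_top.ne ?_ ?_
    · exact (continuous_subtype_val.comp (Real.continuous_fourierChar.comp
        (by fun_prop))).aestronglyMeasurable
    · exact .of_forall fun ξ => (Circle.norm_coe _).le
  refine le_trans ?_ (Complex.re_le_norm _)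
  rw [← RCLike.re_eq_complex_re, ← integral_re hint]
  calc volume.real (Metric.ball (0 : R3) r) / 2
      = ∫ ξ in Metric.ball (0 : R3) r, (1 / 2 : ℝ) := by simp [div_eq_mul_inv]
    _ ≤ _ := by
      refine setIntegral_mono_on ?_ hint.re measurableSet_ball fun ξ hξ => ?_
      · exact integrableOn_const measure_ball_lt_top.ne
      · rw [Real.fourierChar_apply, RCLike.re_eq_complex_re, Complex.exp_ofReal_mul_I_re]
        set θ := 2 * Real.pi * inner ℝ ξ x with hθ
        have h1 : |θ| ≤ 1 := by
          rw [hθ, abs_mul, abs_of_pos (by positivity : (0 : ℝ) < 2 * Real.pi)]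
          have h2 := abs_real_inner_le_norm ξ x
          have h3 : ‖ξ‖ ≤ r := (mem_ball_zero_iff.1 hξ).le
          calc 2 * Real.pi * |inner ℝ ξ x| ≤ 2 * Real.pi * (r * ‖x‖) := by
                gcongr
                exact h2.trans (by gcongr)
            _ ≤ 1 := by linarith
        have h2 := Real.one_sub_sq_div_two_le_cos (x := θ)
        have h3 := (sq_le_one_iff_abs_le_one θ).2 h1
        linarith

/-- The normalized state at rest with momentum spread `r`, in Fourier variables. -/
def restProfile (r : ℝ) : L2 :=
  indicatorConstLp 2 (measurableSet_ball (x := (0 : R3)) (ε := r)) measure_ball_lt_top.ne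
    (EuclideanSpace.single 2 (((√(volume.real (Metric.ball (0 : R3) r)))⁻¹ : ℝ) : ℂ))

/-- The normalized state at rest with momentum spread `r`. -/
def restState (r : ℝ) : L2 := 𝓕⁻ (restProfile r)

lemma fourier_restState (r : ℝ) : 𝓕 (restState r) = restProfile r :=
  FourierTransform.fourier_fourierInv_eq _

lemma volume_real_ball_pos {r : ℝ} (hr : 0 < r) : 0 < volume.real (Metric.ball (0 : R3) r) :=
  ENNReal.toReal_pos (Metric.measure_ball_pos volume _ hr).ne' measure_ball_lt_top.ne

lemma norm_restState {r : ℝ} (hr : 0 < r) : ‖restState r‖ = 1 := by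
  have hv := volume_real_ball_pos hr
  rw [← Lp.norm_fourier_eq, fourier_restState, restProfile,
    norm_indicatorConstLp (by norm_num) (by norm_num), PiLp.norm_single,
    Complex.norm_real, Real.norm_of_nonneg (by positivity), ENNReal.toReal_ofNat,
    ← Real.sqrt_eq_rpow]
  exact inv_mul_cancel₀ (Real.sqrt_pos.2 hv).ne'

lemma coeFn_restState (r : ℝ) : restState r =ᵐ[volume] fun x =>
    (∫ ξ in Metric.ball (0 : R3) r, (Real.fourierChar (inner ℝ ξ x) : ℂ)) •
      (EuclideanSpace.single 2
        (((√(volume.real (Metric.ball (0 : R3) r)))⁻¹ : ℝ) : ℂ) : Spinor) := by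
  have hint : Integrable (restProfile r) := integrable_indicatorConstLp _ _ _
  filter_upwards [coeFn_fourierInv_of_integrable (restProfile r) hint] with x hx
  rw [restState, hx, Real.fourierInv_eq, ← integral_smul_const,
    ← integral_indicator measurableSet_ball]
  refine integral_congr_ae ?_
  filter_upwards [indicatorConstLp_coeFn (p := 2) (hs := measurableSet_ball (x := (0 : R3))
    (ε := r)) (hμs := measure_ball_lt_top.ne) (c := (EuclideanSpace.single 2
      (((√(volume.real (Metric.ball (0 : R3) r)))⁻¹ : ℝ) : ℂ) : Spinor))] with ξ hξ
  rw [restProfile, hξ]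
  by_cases h : ξ ∈ Metric.ball (0 : R3) r
  · rw [Set.indicator_of_mem h, Set.indicator_of_mem h]
    rfl
  · rw [Set.indicator_of_notMem h, Set.indicator_of_notMem h, smul_zero]

/-- A bound for momentum space integrals of the state at rest. -/
lemma lintegral_restProfile_le {r b : ℝ} (hr : 0 < r) {f : R3 → ℝ≥0∞} {F : R3 → Spinor → Spinor}
    (hF0 : ∀ ξ, F ξ 0 = 0)
    (hF : ∀ ξ c, ‖ξ‖ < r → f ξ * ‖F ξ (EuclideanSpace.single 2 c)‖ₑ ^ 2 ≤
      ENNReal.ofReal b * ‖(EuclideanSpace.single 2 c : Spinor)‖ₑ ^ 2) :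
    ∫⁻ ξ, f ξ * ‖F ξ (restProfile r ξ)‖ₑ ^ 2 ≤ ENNReal.ofReal b := by
  calc ∫⁻ ξ, f ξ * ‖F ξ (restProfile r ξ)‖ₑ ^ 2
      ≤ ∫⁻ ξ, ENNReal.ofReal b * ‖restProfile r ξ‖ₑ ^ 2 := by
        refine lintegral_mono_ae ?_
        filter_upwards [indicatorConstLp_coeFn (p := 2) (hs := measurableSet_ball (x := (0 : R3))
          (ε := r)) (hμs := measure_ball_lt_top.ne) (c := (EuclideanSpace.single 2
            (((√(volume.real (Metric.ball (0 : R3) r)))⁻¹ : ℝ) : ℂ) : Spinor))] with ξ hξ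
        rw [restProfile, hξ]
        by_cases h : ξ ∈ Metric.ball (0 : R3) r
        · rw [Set.indicator_of_mem h]
          exact hF ξ _ (mem_ball_zero_iff.1 h)
        · rw [Set.indicator_of_notMem h, hF0]
          simp
    _ = ENNReal.ofReal b := by
        rw [lintegral_const_mul' _ _ ENNReal.ofReal_ne_top, ← fourier_restState,
          lintegral_fourier_enorm_sq_eq, ← ofReal_norm, norm_restState hr]
        simp

lemma sobolevEnergy_restState_le {r : ℝ} (hr : 0 < r) :
    sobolevEnergy (restState r) ≤ ENNReal.ofReal (1 + (2 * Real.pi * r) ^ 2 / 2) := by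
  rw [sobolevEnergy, fourier_restState]
  refine lintegral_restProfile_le (F := fun _ a => a) hr (fun _ => rfl) fun ξ c hξ => ?_
  gcongr
  have h : ‖(2 * Real.pi) • ξ‖ ≤ 2 * Real.pi * r := by
    rw [norm_smul, Real.norm_of_nonneg (by positivity)]
    gcongr
  have h2 : ‖(2 * Real.pi) • ξ‖ ^ 2 ≤ (2 * Real.pi * r) ^ 2 := by gcongr
  rw [lam, Real.sqrt_le_left (by positivity)]
  nlinarith [sq_nonneg ((2 * Real.pi * r) ^ 2)]

lemma sobolevEnergy_projMinus_restState_le {r : ℝ} (hr : 0 < r) :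
    sobolevEnergy (projMinus (restState r)) ≤ ENNReal.ofReal ((2 * Real.pi * r) ^ 2 / 4) := by
  have h : sobolevEnergy (projMinus (restState r)) =
      ∫⁻ ξ, ENNReal.ofReal (lam ((2 * Real.pi) • ξ)) * ‖projFun (-1) ξ (restProfile r ξ)‖ₑ ^ 2 := by
    refine lintegral_congr_ae ?_
    filter_upwards [coeFn_fourier_spectralProj (-1) (restState r)] with ξ hξ
    rw [hξ, fourier_restState]
  rw [h]
  refine lintegral_restProfile_le (F := fun ξ a => projFun (-1) ξ a) hr (fun _ => map_zero _)
    fun ξ c hξ => ?_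
  rw [← ofReal_norm, ← ofReal_norm, ← ENNReal.ofReal_pow (norm_nonneg _),
    ← ENNReal.ofReal_pow (norm_nonneg _), ← ENNReal.ofReal_mul (lam_pos _).le,
    ← ENNReal.ofReal_mul (by positivity), PiLp.norm_single]
  refine ENNReal.ofReal_le_ofReal ((lam_mul_norm_sq_projFun_single_le ξ c).trans ?_)
  gcongr
  rw [norm_smul, Real.norm_of_nonneg (by positivity)]
  gcongr

lemma restState_mem_HHalf {r : ℝ} (hr : 0 < r) : restState r ∈ HHalf :=
  (mem_HHalf_iff _).2 ((sobolevEnergy_restState_le hr).trans_lt ENNReal.ofReal_lt_top)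

/-- The self-interaction of the state at rest is of first order in the momentum spread. -/
lemma interaction_restState_ge {r : ℝ} (hr : 0 < r) :
    1 / (648 * Real.pi ^ 2) * (2 * Real.pi * r) ≤ interaction (restState r) := by
  -- On the ball of radius `R` the Fourier integral stays above half of its value at the origin. A
  -- fixed fraction of the mass then lies at mutual distance at most `2R`, which gives an
  -- interaction of order `1/R`.
  set R : ℝ := (2 * Real.pi * r)⁻¹ with hR
  have hR0 : 0 < R := by positivity
  set β := volume.real (Metric.ball (0 : R3) r) with hβ
  have hβ0 : 0 < β := volume_real_ball_pos hr
  have hβv : β = 4 * Real.pi / 3 * r ^ 3 := by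
    rw [hβ, Measure.real, EuclideanSpace.volume_ball_fin_three, ENNReal.toReal_mul,
      ENNReal.toReal_pow, ENNReal.toReal_ofReal hr.le, ENNReal.toReal_ofReal (by positivity)]
    ring
  have hBv : volume (Metric.ball (0 : R3) R) = ENNReal.ofReal (4 * Real.pi / 3 * R ^ 3) := by
    rw [EuclideanSpace.volume_ball_fin_three, ← ENNReal.ofReal_pow hR0.le,
      ← ENNReal.ofReal_mul (by positivity)]
    congr 1
    ring
  set I : R3 → ℂ := fun x => ∫ ξ in Metric.ball (0 : R3) r, (Real.fourierChar (inner ℝ ξ x) : ℂ)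
  have hI : ∀ x ∈ Metric.ball (0 : R3) R, β / 2 ≤ ‖I x‖ := by
    intro x hx
    refine norm_integral_fourierChar_ge x ?_
    have h1 : ‖x‖ ≤ R := (mem_ball_zero_iff.1 hx).le
    calc 2 * Real.pi * r * ‖x‖ ≤ 2 * Real.pi * r * R := by gcongr
      _ = 1 := mul_inv_cancel₀ (by positivity)
  have hlow : ENNReal.ofReal ((β / 4) ^ 2 / (2 * R)) * volume (Metric.ball (0 : R3) R) *
      volume (Metric.ball (0 : R3) R) ≤ coulombForm (restState r) (restState r) := by
    rw [coulombForm, Measure.volume_eq_prod, lintegral_prod _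
      (measurable_coulombForm_integrand _ _).ennreal_ofReal.aemeasurable]
    calc _ = ∫⁻ x in Metric.ball (0 : R3) R, ∫⁻ y in Metric.ball (0 : R3) R,
          ENNReal.ofReal ((β / 4) ^ 2 / (2 * R)) := by simp
      _ ≤ ∫⁻ x in Metric.ball (0 : R3) R, ∫⁻ y in Metric.ball (0 : R3) R, ENNReal.ofReal
          (spinForm (restState r x) (restState r y) / ‖x - y‖) := by
        refine lintegral_mono_ae ?_
        filter_upwards [ae_restrict_of_ae (coeFn_restState r),
          ae_restrict_mem measurableSet_ball] with x hx hxB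
        refine lintegral_mono_ae ?_
        filter_upwards [ae_restrict_of_ae (coeFn_restState r),
          ae_restrict_mem measurableSet_ball,
          ae_restrict_of_ae (show ∀ᵐ y : R3, y ≠ x by simp [ae_iff])] with y hy hyB hyx
        refine ENNReal.ofReal_le_ofReal ?_
        have hd : 0 < ‖x - y‖ := norm_pos_iff.2 (sub_ne_zero.2 (Ne.symm hyx))
        have hd2 : ‖x - y‖ ≤ 2 * R := by
          have := norm_sub_le x y
          linarith [mem_ball_zero_iff.1 hxB, mem_ball_zero_iff.1 hyB]
        rw [hx, hy, spinForm_smul_left, spinForm_smul_right, spinForm_single_self]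
        have hc : ‖(((√β)⁻¹ : ℝ) : ℂ)‖ ^ 4 = (β ^ 2)⁻¹ := by
          rw [Complex.norm_real, Real.norm_of_nonneg (by positivity), inv_pow,
            show (4 : ℕ) = 2 * 2 from rfl, pow_mul, Real.sq_sqrt hβ0.le]
        rw [hc]
        calc (β / 4) ^ 2 / (2 * R) = (β / 2) ^ 2 * ((β / 2) ^ 2 * (β ^ 2)⁻¹) / (2 * R) := by
              field_simp
              ring
          _ ≤ _ := by
              gcongr
              · exact hI x hxB
              · exact hI y hyB
      _ ≤ ∫⁻ x, ∫⁻ y, ENNReal.ofReal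
          (spinForm (restState r x) (restState r y) / ‖x - y‖) :=
        (lintegral_mono fun x => setLIntegral_le_lintegral _ _).trans
          (setLIntegral_le_lintegral _ _)
  rw [interaction_eq_toReal, ← ENNReal.ofReal_le_iff_le_toReal
    (coulombForm_lt_top (restState_mem_HHalf hr) _).ne]
  refine le_trans (le_of_eq ?_) hlow
  rw [hBv, ← ENNReal.ofReal_mul (by positivity), ← ENNReal.ofReal_mul (by positivity)]
  congr 1
  rw [hβv, hR]
  field_simp
  ring

/-- Binding: the level lies below the mass of the free particle. -/
lemma level_lt_one {e m : ℝ} (he : e ≠ 0) (hm : 0 < m) (hκ : m * (e ^ 2 / 2) ≤ 1 / 261) :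
    level e m < 1 := by
  set κ := m * (e ^ 2 / 2) with hκd
  have hκ0 : 0 < κ := by positivity
  set C : ℝ := 1 / (648 * Real.pi ^ 2) with hC
  have hC0 : 0 < C := by positivity
  have hC1 : C ≤ 1 := by
    rw [hC, div_le_one (by positivity)]
    nlinarith [Real.pi_gt_three]
  set η : ℝ := κ * C / 400 with hη
  -- The choice of `η` makes the guaranteed gain `κ · (Cη/4)/100` equal to `η²`.
  have hη0 : 0 < η := by positivity
  have hη1 : η ≤ C / 400 := by
    rw [hη]
    nlinarith
  set r : ℝ := η / (2 * Real.pi) with hr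
  have hr0 : 0 < r := by positivity
  have hrη : 2 * Real.pi * r = η := by
    rw [hr]
    field_simp
  set u := restState r with hu
  have huH : u ∈ HHalf := restState_mem_HHalf hr0
  have hpH : projPlus u ∈ HHalf := spectralProj_mem_HHalf (Or.inl rfl) huH
  have hmH : projMinus u ∈ HHalf := spectralProj_mem_HHalf (Or.inr rfl) huH
  have hnu : ‖u‖ = 1 := norm_restState hr0
  have hpyth := norm_sq_projPlus_add u
  rw [hnu] at hpyth
  have hNp : normSqHHalf (projPlus u) ≤ 1 + η ^ 2 / 2 := by
    rw [normSqHHalf_eq_toReal, ← hrη]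
    refine ENNReal.toReal_le_of_le_ofReal (by positivity) ?_
    exact (sobolevEnergy_spectralProj_le (Or.inl rfl) u).trans (sobolevEnergy_restState_le hr0)
  have hNm : normSqHHalf (projMinus u) ≤ η ^ 2 / 4 := by
    rw [normSqHHalf_eq_toReal, ← hrη]
    exact ENNReal.toReal_le_of_le_ofReal (by positivity)
      (sobolevEnergy_projMinus_restState_le hr0)
  have hLm := norm_sq_le_normSqHHalf hmH
  have hp1 : ‖projPlus u‖ ≤ 1 := by
    nlinarith [sq_nonneg ‖projMinus u‖, norm_nonneg (projPlus u)]
  have hVu : C * η ≤ interaction u := by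
    have := interaction_restState_ge hr0
    rwa [hrη] at this
  have hst := sqrt_interaction_sub_le hpH (HHalf.smul_mem (-1 : ℂ) hmH)
  -- Stability is applied to `u` as `projPlus u` minus `-projMinus u`: removing the negative part
  -- costs `O(η)` in the square root of the interaction, against a main term of order `√(Cη)`.
  rw [normSqHHalf_smul, neg_smul, one_smul, sub_neg_eq_add, projPlus_add_projMinus, hnu,
    norm_neg, norm_one, one_pow, one_mul] at hst
  have hV : C * η / 4 ≤ interaction (projPlus u) := by
    have h1 : √(C * η) ≤ √(interaction u) := Real.sqrt_le_sqrt hVu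
    have h2 : √6 * (1 + ‖projPlus u‖) * √(normSqHHalf (projMinus u)) ≤ √6 * (1 + 1) * (η / 2) := by
      gcongr
      rw [Real.sqrt_le_left (by positivity)]
      linarith
    have h3 : √6 * η ≤ √(C * η) / 2 := by
      refine le_of_sq_le_sq ?_ (by positivity)
      rw [mul_pow, div_pow (√_), Real.sq_sqrt (by positivity), Real.sq_sqrt (by positivity)]
      nlinarith
    have h4 : √(C * η) / 2 ≤ √(interaction (projPlus u)) := by linarith
    have h5 := pow_le_pow_left₀ (by positivity) h4 2
    rw [div_pow, Real.sq_sqrt (by positivity), Real.sq_sqrt (interaction_nonneg _)] at h5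
    linarith
  have hηsmall : η < 1 := by linarith
  refine level_lt_one_of_mem_HHalf hm.le hκ huH ?_ hnu.le ?_
  · intro h0
    rw [h0, norm_zero] at hpyth
    nlinarith
  · have h1 : κ * (C * η / 4 / 100) ≤ κ * (interaction (projPlus u) / 100) := by gcongr
    have h2 : κ * (C * η / 4 / 100) = η ^ 2 := by
      rw [hη]
      ring
    rw [← hκd]
    -- The energy minus the gain is at most `1 + η²/2 - η²`, below `1 - η²/4 ≤ ‖projPlus u‖²`.
    nlinarith

end MaxwellDirac

end

/-! ### Subadditivity from strict monotonicity -/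

open MaxwellDirac

theorem mainTheorem4 (e : ℝ) (he : e ≠ 0) (hK : e ^ 2 * (Real.pi / 2) < 1 / 87)
    (m m₁ m₂ : ℝ) (hm : m ∈ Set.Ioc (0 : ℝ) 1) (hm₁ : m₁ ∈ Set.Ioo (0 : ℝ) 1)
    (hm₂ : m₂ ∈ Set.Ioo (0 : ℝ) 1) (hsum : m₁ + m₂ = m) :
    MaxwellDirac.energyLevel e m <
      MaxwellDirac.energyLevel e m₁ + MaxwellDirac.energyLevel e m₂ := by
  -- `261 = 3 · 87`: the hypothesis on the charge is used with `π > 3`.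
  have hκ : m * (e ^ 2 / 2) ≤ 1 / 261 := by
    have h1 : e ^ 2 / 2 ≤ 1 / 261 := by
      nlinarith [Real.pi_gt_three, sq_nonneg e]
    nlinarith [hm.1, hm.2, sq_nonneg e]
  have hlt1 := level_lt_one he hm.1 hκ
  have h0 := level_nonneg hκ
  obtain ⟨r, hr⟩ : ∃ r : ℝ, level e m = r :=
    ⟨(level e m).toReal, (EReal.coe_toReal (hlt1.trans_le le_top).ne
      ((EReal.bot_lt_zero).trans_le h0).ne').symm⟩
  have hr1 : r < 1 := by
    rw [hr] at hlt1
    exact_mod_cast hlt1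
  obtain ⟨r₁, hr₁, hl₁⟩ := exists_lt_le_level he hm₁.1.le (by linarith [hm₂.1]) hκ hr hr1
  obtain ⟨r₂, hr₂, hl₂⟩ := exists_lt_le_level he hm₂.1.le (by linarith [hm₁.1]) hκ hr hr1
  have hE : ∀ {m' r' : ℝ}, 0 < m' → (r' : EReal) ≤ level e m' →
      ((m' * r' : ℝ) : EReal) ≤ energyLevel e m' := by
    intro m' r' hm' h
    rw [energyLevel, EReal.coe_mul]
    exact mul_le_mul_of_nonneg_left h (EReal.coe_nonneg.2 hm'.le)
  calc energyLevel e m = ((m * r : ℝ) : EReal) := by rw [energyLevel, hr, EReal.coe_mul]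
    _ < ((m₁ * r₁ + m₂ * r₂ : ℝ) : EReal) := by
        rw [EReal.coe_lt_coe_iff, ← hsum]
        nlinarith [mul_pos hm₁.1 (sub_pos.2 hr₁), mul_pos hm₂.1 (sub_pos.2 hr₂)]
    _ ≤ _ := by
        rw [EReal.coe_add]
        exact add_le_add (hE hm₁.1 hl₁) (hE hm₂.1 hl₂)
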